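/- All spaces are nonzero finite-dimensional complex inner product spaces with fixed standard bases; $L(\mathcal V)$ denotes the linear operators on $\mathcal V$, and $A\le B$ means that $B-A$ is positive semidefinite. A linear map between operator spaces is admissible if it is completely positive and trace preserving. Its Choi–Jamiołkowski operator is $J(\Phi)=\sum_{i,j}\Phi(|i\rangle\langle j|)\otimes|i\rangle\langle j|$. Let $n\ge 1$ and let $\mathcal X_1,\dots,\mathcal X_n$ and $\mathcal Y_1,\dots,\mathcal Y_n$ be spaces; write $\mathcal X_{1\ldots n}=\mathcal X_1\otimes\cdots\otimes\mathcal X_n$, and likewise $\mathcal Y_{1\ldots n}$. An $n$-turn strategy consists of memory spaces $\mathcal Z_1,\dots,\mathcal Z_n$ and admissible maps $\Phi_1:L(\mathcal X_1)\to L(\mathcal Y_1\otimes\mathcal Z_1)$ and $\Phi_k:L(\mathcal X_k\otimes\mathcal Z_{k-1})\to L(\mathcal Y_k\otimes\mathcal Z_k)$ for $2\le k\le n$. A compatible $n$-turn co-strategy consists of memory spaces $\mathcal W_0,\dots,\mathcal W_n$, a density operator $\rho_0$ on $\mathcal X_1\otimes\mathcal W_0$, and admissible maps $\Psi_k:L(\mathcal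 Y_k\otimes\mathcal W_{k-1})\to L(\mathcal X_{k+1}\otimes\mathcal W_k)$ for $1\le k<n$ and $\Psi_n:L(\mathcal Y_n\otimes\mathcal W_{n-1})\to L(\mathcal W_n)$. A measuring strategy (co-strategy) has in addition a measurement, that is, a finite family of positive semidefinite operators with sum $I$, indexed by a finite set of outcomes, on its last memory space. In an interaction of a strategy and a compatible co-strategy the maps $\Phi_1,\Psi_1,\dots,\Phi_n,\Psi_n$ are applied in this order to $\rho_0$, each on its own systems, giving a state $\sigma$ on $\mathcal Z_n\otimes\mathcal W_n$. If the strategy measures $\{P_a\}$, its output is $a$ with probability $\operatorname{tr}((P_a\otimes I)\sigma)$; if the co-strategy measures $\{P_b\}$, its output is $b$ with probability $\operatorname{tr}((I\otimes P_b)\sigma)$. The maps of a strategy compose, the inputs being fed in one at a time, to a map $L(\mathcal X_{1\ldots n})\to L(\mathcal Y_{1\ldots n}\otimes\mathcal Z_n)$. Let $\Xi:L(\mathcal X_{1\ldots n})\to L(\mathcal Y_{1\ldots n})$ be this map followed by $\operatorname{tr}_{\mathcal Z_n}$ and, for a measuring strategy, let $\Xi_a$ be this map followed by $A\mapsto\operatorname{tr}_{\mathcal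 Z_n}((I\otimes P_a)A)$. The representation of the strategy is $J(\Xi)$, and that of the measuring strategy is the family $Q_a=J(\Xi_a)$. Representations of co-strategies are defined likewise from the maps $L(\mathcal Y_{1\ldots n})\to L(\mathcal X_{1\ldots n})$ that they compute, except that the resulting operators are transposed with respect to the standard basis (and regarded as operators on $\mathcal Y_{1\ldots n}\otimes\mathcal X_{1\ldots n}$). Let $\mathcal S_n$ and $\text{co-}\mathcal S_n$ be the sets of all representations of (non-measuring) $n$-turn strategies and co-strategies for these spaces. **Theorem.** Let $\{Q_a:a\in\Sigma\}$ be the representation of an $n$-turn measuring strategy with input spaces $\mathcal X_1,\dots,\mathcal X_n$ and output spaces $\mathcal Y_1,\dots,\mathcal Y_n$. Then for each $a\in\Sigma$ the maximum, over all compatible co-strategies, of the probability that this strategy outputs $a$ exists and is equal to $$\min\{p\in[0,1]\,:\,Q_a\le pR\ \text{ for some } R\in\mathcal S_n\},$$ this minimum also being attained. Likewise, if $\{Q_b:b\in\Gamma\}$ is the representation of an $n$-turn measuring co-strategy to these spaces, then for each $b\in\Gamma$ the maximum, over all compatible strategies, of the probability that this co-strategy outputs $b$ exists and is equal to the attained minimum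 $$\min\{p\in[0,1]\,:\,Q_b\le pR\ \text{ for some } R\in\text{co-}\mathcal S_n\}.$$ -/

import Mathlib

open scoped Kronecker ComplexOrder

/-! Complex Euclidean spaces come with a fixed standard basis, so a space is given by the finite type
that indexes its basis, an operator is a square matrix, and a tensor product of spaces is given by the
product of the index types. A one-point index type gives the space `ℂ`. -/

universe u v

/-- The operators `L(ℂ^a)` on the space with standard basis indexed by `a`. -/
abbrev Op (a : Type*) := Matrix a a ℂ

/-- Super-operators: linear maps `L(ℂ^a) → L(ℂ^b)`. -/
abbrev SuperOp (a b : Type*) := Op a →ₗ[ℂ] Op b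

/-- `Φ ⊗ id` acting on `L(ℂ^a ⊗ ℂ^c)`: the map `Φ` is applied to every block. -/
def SuperOp.tensorId {a b : Type*} (Φ : SuperOp a b) (c : Type*) : SuperOp (a × c) (b × c) where
  toFun A := Matrix.of fun i j => Φ (Matrix.of fun p q => A (p, i.2) (q, j.2)) i.1 j.1
  map_add' A B := by
    ext i j
    exact congrFun (congrFun (map_add Φ (Matrix.of fun p q => A (p, i.2) (q, j.2))
      (Matrix.of fun p q => B (p, i.2) (q, j.2))) i.1) j.1
  map_smul' r A := by
    ext i j
    exact congrFun (congrFun (map_smul Φ r (Matrix.of fun p q => A (p, i.2) (q, j.2))) i.1) j.1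

/-- Renaming the standard basis along a bijection (reordering of tensor factors). -/
def relabel {a b : Type*} (e : a ≃ b) : SuperOp a b :=
  (Matrix.reindexLinearEquiv ℂ ℂ e e).toLinearMap

/-- `id ⊗ Φ` acting on `L(ℂ^c ⊗ ℂ^a)`. -/
def SuperOp.idTensor (c : Type*) {a b : Type*} (Φ : SuperOp a b) : SuperOp (c × a) (c × b) :=
  relabel (Equiv.prodComm b c) ∘ₗ Φ.tensorId c ∘ₗ relabel (Equiv.prodComm c a)

/-- Partial trace over the second tensor factor. -/
def partialTrace {a : Type*} (c : Type*) [Fintype c] : SuperOp (a × c) a where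
  toFun A := Matrix.of fun i j => ∑ k, A (i, k) (j, k)
  map_add' A B := by
    ext i j
    simp [Finset.sum_add_distrib]
  map_smul' r A := by
    ext i j
    simp [Finset.mul_sum]

/-- The map `A ↦ tr_c ((I ⊗ P) A)` attached to a measurement operator `P` on the second factor. -/
def effect {a c : Type*} [Fintype a] [DecidableEq a] [Fintype c] (P : Op c) : SuperOp (a × c) a :=
  partialTrace c ∘ₗ LinearMap.mulLeft ℂ ((1 : Op a) ⊗ₖ P)

/-- The map `A ↦ A ⊗ τ` that puts a further system in the state `τ`. -/
def appendState (a : Type*) {c : Type*} (τ : Op c) : SuperOp a (a × c) where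
  toFun A := A ⊗ₖ τ
  map_add' A B := Matrix.add_kronecker A B τ
  map_smul' r A := Matrix.smul_kronecker r A τ

/-- Positive super-operators. -/
def SuperOp.Positive {a b : Type*} (Φ : SuperOp a b) : Prop :=
  ∀ A : Op a, A.PosSemidef → (Φ A).PosSemidef

/-- Completely positive super-operators: `Φ ⊗ id` is positive for every auxiliary space. -/
def SuperOp.CompletelyPositive {a b : Type*} (Φ : SuperOp a b) : Prop :=
  ∀ d : ℕ, (Φ.tensorId (Fin d)).Positive

/-- Admissible super-operators: completely positive and trace preserving. -/
def SuperOp.Admissible {a b : Type*} [Fintype a] [Fintype b] (Φ : SuperOp a b) : Prop :=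
  Φ.CompletelyPositive ∧ ∀ A : Op a, (Φ A).trace = A.trace

/-- The Choi-Jamiolkowski representation `J(Φ) = ∑ i j, Φ(|i⟩⟨j|) ⊗ |i⟩⟨j|`. -/
def choi {a b : Type*} [Fintype a] [DecidableEq a] (Φ : SuperOp a b) : Op (b × a) :=
  ∑ i : a, ∑ j : a, Φ (Matrix.single i j 1) ⊗ₖ Matrix.single i j (1 : ℂ)

/-- Density operators. -/
def IsDensity {a : Type*} [Fintype a] (ρ : Op a) : Prop :=
  ρ.PosSemidef ∧ ρ.trace = 1

/-- Measurements with outcome set `S` on the space indexed by `a`. -/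
structure Measurement (S : Type*) [Fintype S] (a : Type*) [Fintype a] [DecidableEq a] where
  /-- the measurement operators -/
  op : S → Op a
  posSemidef : ∀ s, (op s).PosSemidef
  sum_eq_one : ∑ s, op s = 1

/-- The tensor product of the first `k` spaces `X 0, …, X (k - 1)`; the empty product is `ℂ`. -/
def Tens (X : ℕ → Type u) : ℕ → Type u
  | 0 => PUnit
  | k + 1 => Tens X k × X k

instance Tens.fintype (X : ℕ → Type u) [∀ k, Fintype (X k)] : ∀ k, Fintype (Tens X k)
  | 0 => inferInstanceAs (Fintype PUnit)
  | k + 1 =>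
    letI := Tens.fintype X k
    inferInstanceAs (Fintype (Tens X k × X k))

instance Tens.decidableEq (X : ℕ → Type u) [∀ k, DecidableEq (X k)] : ∀ k, DecidableEq (Tens X k)
  | 0 => inferInstanceAs (DecidableEq PUnit)
  | k + 1 =>
    letI := Tens.decidableEq X k
    inferInstanceAs (DecidableEq (Tens X k × X k))

/-- If `F` has output `b ⊗ z` with `z` a memory, then `feed F G` sends a further input `x`, together with
the memory `z`, through `G`, and leaves `b` alone: it is `(id_b ⊗ G) ∘ (F ⊗ id_x)`. -/
def feed {a b z x o : Type*} (F : SuperOp a (b × z)) (G : SuperOp (x × z) o) :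
    SuperOp (a × x) (b × o) :=
  SuperOp.idTensor b G ∘ₗ
    relabel ((Equiv.prodAssoc b z x).trans ((Equiv.refl b).prodCongr (Equiv.prodComm z x))) ∘ₗ
      F.tensorId x

section Games

variable (n m : ℕ) (X Y : ℕ → Type u)
variable [∀ k, Fintype (X k)] [∀ k, DecidableEq (X k)] [∀ k, Fintype (Y k)] [∀ k, DecidableEq (Y k)]

/-- `n`-turn (non-measuring) strategies with input spaces `X 0, …, X (n - 1)` and output spaces
`Y 0, …, Y (n - 1)`. The memory spaces are `Z 1, …, Z n`, and `Z 0 = ℂ`, so that the first map has the form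
`L(X 0) → L(Y 0 ⊗ Z 1)`. Entries of the sequences beyond those listed play no role. -/
structure Strategy where
  /-- the memory spaces -/
  Z : ℕ → Type u
  [fintypeZ : ∀ k, Fintype (Z k)]
  [decidableEqZ : ∀ k, DecidableEq (Z k)]
  card_Z_zero : Fintype.card (Z 0) = 1
  /-- the maps applied in the successive turns -/
  Φ : ∀ k, SuperOp (X k × Z k) (Y k × Z (k + 1))
  admissible : ∀ k, k < n → (Φ k).Admissible

/-- `(m + 1)`-turn (non-measuring) co-strategies to the same spaces: memory spaces `W 0, …, W m` and
`Wlast`, an initial state on `X 0 ⊗ W 0`, the maps `Ψ 0, …, Ψ (m - 1)` and the last map `Ψlast`.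
Entries of the sequences beyond those listed play no role. -/
structure CoStrategy where
  /-- the memory spaces but the last -/
  W : ℕ → Type u
  /-- the last memory space -/
  Wlast : Type u
  [fintypeW : ∀ k, Fintype (W k)]
  [decidableEqW : ∀ k, DecidableEq (W k)]
  [fintypeWlast : Fintype Wlast]
  [decidableEqWlast : DecidableEq Wlast]
  /-- the initial state -/
  ρ : Op (X 0 × W 0)
  isDensity : IsDensity ρ
  /-- the maps but the last -/
  Ψ : ∀ k, SuperOp (Y k × W k) (X (k + 1) × W (k + 1))
  admissible : ∀ k, k < m → (Ψ k).Admissible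
  /-- the last map -/
  Ψlast : SuperOp (Y m × W m) Wlast
  admissible_last : Ψlast.Admissible

attribute [instance] Strategy.fintypeZ Strategy.decidableEqZ
attribute [instance] CoStrategy.fintypeW CoStrategy.decidableEqW
attribute [instance] CoStrategy.fintypeWlast CoStrategy.decidableEqWlast

variable {n m X Y}

/-! ### Choi-Jamiolkowski representations -/

/-- The super-operator computed by the first `k` turns, with the memory space kept. -/
def Strategy.run (s : Strategy n X Y) : ∀ k, SuperOp (Tens X k) (Tens Y k × s.Z k)
  | 0 => appendState (Tens X 0) (1 : Op (s.Z 0))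
  | k + 1 =>
    relabel (Equiv.prodAssoc (Tens Y k) (Y k) (s.Z (k + 1))).symm ∘ₗ feed (s.run k) (s.Φ k)

/-- The representation of a non-measuring strategy. -/
def Strategy.rep (s : Strategy n X Y) : Op (Tens Y n × Tens X n) :=
  choi (partialTrace (s.Z n) ∘ₗ s.run n)

/-- The representation of the measuring strategy that measures `M` at the end. -/
def Strategy.measRep (s : Strategy n X Y) {S : Type v} [Fintype S] (M : Measurement S (s.Z n)) (a : S) :
    Op (Tens Y n × Tens X n) :=
  choi (effect (M.op a) ∘ₗ s.run n)

/-- The super-operator computed by the initial state and the first `k` maps of a co-strategy, with the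
memory space kept. -/
def CoStrategy.run (c : CoStrategy m X Y) : ∀ k, SuperOp (Tens Y k) (Tens X (k + 1) × c.W k)
  | 0 => relabel (Equiv.prodAssoc (Tens X 0) (X 0) (c.W 0)).symm ∘ₗ
      appendState (Tens Y 0) c.ρ
  | k + 1 =>
    relabel (Equiv.prodAssoc (Tens X (k + 1)) (X (k + 1)) (c.W (k + 1))).symm ∘ₗ
      feed (c.run k) (c.Ψ k)

/-- The super-operator computed by the whole co-strategy, with the last memory space kept. -/
def CoStrategy.runAll (c : CoStrategy m X Y) : SuperOp (Tens Y (m + 1)) (Tens X (m + 1) × c.Wlast) :=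
  feed (c.run m) c.Ψlast

/-- The representation of a non-measuring co-strategy: the transposed Choi-Jamiolkowski operator, with the
tensor factors ordered as for strategies. -/
def CoStrategy.rep (c : CoStrategy m X Y) : Op (Tens Y (m + 1) × Tens X (m + 1)) :=
  relabel (Equiv.prodComm (Tens X (m + 1)) (Tens Y (m + 1)))
    (choi (partialTrace c.Wlast ∘ₗ c.runAll)).transpose

/-- The representation of the measuring co-strategy that measures `M` at the end. -/
def CoStrategy.measRep (c : CoStrategy m X Y) {S : Type v} [Fintype S] (M : Measurement S c.Wlast)
    (b : S) : Op (Tens Y (m + 1) × Tens X (m + 1)) :=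
  relabel (Equiv.prodComm (Tens X (m + 1)) (Tens Y (m + 1)))
    (choi (effect (M.op b) ∘ₗ c.runAll)).transpose

variable (n m X Y)

/-- The set of all representations of `n`-turn strategies. -/
def strategyReps : Set (Op (Tens Y n × Tens X n)) :=
  {R | ∃ s : Strategy n X Y, s.rep = R}

/-- The set of all representations of `(m + 1)`-turn co-strategies. -/
def coStrategyReps : Set (Op (Tens Y (m + 1) × Tens X (m + 1))) :=
  {R | ∃ c : CoStrategy m X Y, c.rep = R}

variable {n m X Y}

/-! ### Interaction -/

/-- The joint state after the strategy acts in turn `k`, given the joint state before. -/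
def strategyMove (s : Strategy n X Y) (c : CoStrategy m X Y) (k : ℕ)
    (σ : Op (s.Z k × (X k × c.W k))) : Op (s.Z (k + 1) × (Y k × c.W k)) :=
  relabel (((Equiv.prodComm (Y k) (s.Z (k + 1))).prodCongr (Equiv.refl (c.W k))).trans
      (Equiv.prodAssoc (s.Z (k + 1)) (Y k) (c.W k)))
    ((s.Φ k).tensorId (c.W k)
      (relabel ((Equiv.prodAssoc (s.Z k) (X k) (c.W k)).symm.trans
        ((Equiv.prodComm (s.Z k) (X k)).prodCongr (Equiv.refl (c.W k)))) σ))

/-- The joint state on `Z k ⊗ X k ⊗ W k` when the strategy has made `k` moves and the co-strategy has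
answered all of them. -/
def interaction (s : Strategy n X Y) (c : CoStrategy m X Y) : ∀ k, Op (s.Z k × (X k × c.W k))
  | 0 => (1 : Op (s.Z 0)) ⊗ₖ c.ρ
  | k + 1 => SuperOp.idTensor (s.Z (k + 1)) (c.Ψ k) (strategyMove s c k (interaction s c k))

/-- The state of the two last memory spaces after all `m + 1` turns. -/
def finalState (s : Strategy (m + 1) X Y) (c : CoStrategy m X Y) : Op (s.Z (m + 1) × c.Wlast) :=
  SuperOp.idTensor (s.Z (m + 1)) c.Ψlast (strategyMove s c m (interaction s c m))

/-- The probability `⟨P ⊗ Q, σ⟩` that measurements of the two last memory spaces yield the outcomes with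
measurement operators `P` and `Q`; a party that does not measure has the operator `1`. -/
noncomputable def outputProb (s : Strategy (m + 1) X Y) (c : CoStrategy m X Y)
    (P : Op (s.Z (m + 1))) (Q : Op c.Wlast) : ℝ :=
  ((P ⊗ₖ Q).conjTranspose * finalState s c).trace.re

end Games

/-! ### Convex duality for positive semidefinite matrices -/

section Duality

open Matrix Filter Topology

variable {d : Type*} [Fintype d] [DecidableEq d]

/-! The theorem is strong duality for a pair of semidefinite programs. An output probability is
bilinear: it is `(Q * T).trace` for the measured operator `Q` of one party and the representation
`T` of the other (`outputProb_strategy_measures`, `outputProb_coStrategy_measures`). Representations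
of strategies are exactly the positive semidefinite elements, of trace the dimension of all inputs,
of a complex subspace `A` (`strategyReps_eq`); those of co-strategies are the ones, of trace the
dimension of all outputs, of a subspace `B` (`coStrategyReps_eq`). These subspaces express
causality: tracing out the latest message sent leaves an identity on the message received just
before. Padding by an identity and partial trace are adjoint, so by induction on the turns `A` and
`B` are orthogonal complements up to the identity operator (`dualPair_strategySpace`), and
normalized elements pair to `1`.

Hence `Q ≤ p R` forces `tr (Q T) ≤ p`. Conversely, if no multiple `q R` dominates `Q`, a separating
hyperplane has a positive semidefinite normal that annihilates the traceless part of `A`, so it lies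
in `B`; rescaled, it represents a co-strategy achieving at least `q`. Compactness of the normalized
slices gives attainment on both sides. The second half exchanges `A` and `B`.

That every element of a slice is realized rests on purification: the constraints unwind into a chain
of positive semidefinite operators, one per turn, whose square roots serve as pure states with
memory. Purifications of the same operator differ by a partial isometry, and this supplies the map
of each turn (`exists_admissible_purification`). -/

theorem eventually_posSemidef_add {ε : ℝ} (hε : 0 < ε) :
    ∀ᶠ D in 𝓝 (0 : Op d), ((ε : ℂ) • (1 : Op d) + (D + Dᴴ)).PosSemidef := by
  set N : ℝ := Fintype.card d + 1 with hN
  have hN0 : 0 < N := by positivity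
  -- Each of `D` and `Dᴴ` changes the quadratic form by at most `δ * N * ‖x‖²`, half of what `ε`
  -- provides. The `+ 1` in `N` keeps it positive when `d` is empty.
  set δ : ℝ := ε / (2 * N) with hδdef
  have hδ : 0 < δ := by positivity
  have h1 : ∀ᶠ D in 𝓝 (0 : Op d), ∀ i j, ‖D i j‖ < δ := by
    rw [eventually_all]; intro i
    rw [eventually_all]; intro j
    have hc : Continuous fun D : Op d => ‖D i j‖ := by fun_prop
    have := hc.tendsto 0
    simp only [Matrix.zero_apply, norm_zero] at this
    exact this.eventually (gt_mem_nhds hδ)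
  filter_upwards [h1] with D hD
  have hh : ((ε : ℂ) • (1 : Op d) + (D + Dᴴ)).IsHermitian := by
    simp [Matrix.IsHermitian, conjTranspose_add, conjTranspose_smul, add_comm]
  refine PosSemidef.of_dotProduct_mulVec_nonneg hh fun x => ?_
  have e1 : star x ⬝ᵥ (((ε : ℂ) • (1 : Op d) + (D + Dᴴ)) *ᵥ x)
      = ((ε * ∑ i, ‖x i‖ ^ 2 : ℝ) : ℂ) +
        (star x ⬝ᵥ (D *ᵥ x) + star (star x ⬝ᵥ (D *ᵥ x))) := by
    rw [add_mulVec, add_mulVec, dotProduct_add, dotProduct_add, smul_mulVec, one_mulVec,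
      dotProduct_smul]
    congr 1
    · simp only [dotProduct, smul_eq_mul, Pi.star_apply, RCLike.star_def]
      push_cast
      congr 1
      exact Finset.sum_congr rfl fun i _ => Complex.conj_mul' _
    · congr 1
      rw [Matrix.star_dotProduct, Matrix.star_mulVec, conjTranspose_conjTranspose,
        ← dotProduct_mulVec]
  have e2 : ‖star x ⬝ᵥ (D *ᵥ x)‖ ≤ δ * (N * ∑ i, ‖x i‖ ^ 2) := by
    calc ‖star x ⬝ᵥ (D *ᵥ x)‖ ≤ ∑ i, ∑ j, ‖x i‖ * (δ * ‖x j‖) := by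
          refine (norm_sum_le _ _).trans (Finset.sum_le_sum fun i _ => ?_)
          rw [norm_mul, Pi.star_apply, norm_star, ← Finset.mul_sum]
          refine mul_le_mul_of_nonneg_left ?_ (norm_nonneg _)
          refine (norm_sum_le _ _).trans (Finset.sum_le_sum fun j _ => ?_)
          rw [norm_mul]
          exact mul_le_mul_of_nonneg_right (hD i j).le (norm_nonneg _)
      _ = δ * (∑ i, ‖x i‖) ^ 2 := by
          rw [sq, Finset.sum_mul_sum, Finset.mul_sum]
          refine Finset.sum_congr rfl fun i _ => ?_
          rw [Finset.mul_sum]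
          exact Finset.sum_congr rfl fun j _ => by ring
      _ ≤ δ * (N * ∑ i, ‖x i‖ ^ 2) := by
          refine mul_le_mul_of_nonneg_left ?_ hδ.le
          refine (sq_sum_le_card_mul_sum_sq (s := Finset.univ) (f := fun i => ‖x i‖)).trans ?_
          refine mul_le_mul_of_nonneg_right ?_ (Finset.sum_nonneg fun i _ => by positivity)
          simp [hN]
  have e3 : 2 * (δ * (N * ∑ i, ‖x i‖ ^ 2)) = ε * ∑ i, ‖x i‖ ^ 2 := by
    rw [hδdef]; field_simp
  have e4 := (abs_le.1 ((Complex.abs_re_le_norm _).trans e2)).1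
  rw [e1, Complex.nonneg_iff]
  constructor
  · simp only [Complex.add_re, Complex.ofReal_re, RCLike.star_def, Complex.conj_re]
    linarith
  · simp only [Complex.add_im, Complex.ofReal_im, RCLike.star_def, Complex.conj_im]
    ring

omit [DecidableEq d] in
theorem isClosed_posSemidef : IsClosed {R : Op d | R.PosSemidef} := by
  have : {R : Op d | R.PosSemidef} =
      {R | Rᴴ = R} ∩ ⋂ x : d → ℂ, {R | 0 ≤ star x ⬝ᵥ (R *ᵥ x)} := by
    ext R
    simp [posSemidef_iff_dotProduct_mulVec, Matrix.IsHermitian]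
  rw [this]
  refine (isClosed_eq (by fun_prop) (by fun_prop)).inter (isClosed_iInter fun x => ?_)
  exact isClosed_le continuous_const (by fun_prop)

/-- Entries of a Gram matrix are inner products of columns, at most the mean of two squared column
norms, and each of these is at most the trace. This bounds the trace slices. -/
theorem Matrix.PosSemidef.norm_apply_le {R : Op d} (hR : R.PosSemidef) (i j : d) :
    ‖R i j‖ ≤ R.trace.re := by
  obtain ⟨C, rfl⟩ : ∃ C : Op d, R = Cᴴ * C := by
    open scoped MatrixOrder in
    exact CStarAlgebra.nonneg_iff_eq_star_mul_self.1 (nonneg_iff_posSemidef.2 hR)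
  have ht : (Cᴴ * C).trace.re = ∑ l, ∑ k, ‖C k l‖ ^ 2 := by
    simp only [Matrix.trace, Matrix.diag, Matrix.mul_apply, conjTranspose_apply, Complex.re_sum]
    refine Finset.sum_congr rfl fun l _ => Finset.sum_congr rfl fun k _ => ?_
    rw [RCLike.star_def, Complex.conj_mul']
    norm_cast
  have hcol : ∀ l, ∑ k, ‖C k l‖ ^ 2 ≤ ∑ l, ∑ k, ‖C k l‖ ^ 2 := fun l =>
    Finset.single_le_sum (f := fun l => ∑ k, ‖C k l‖ ^ 2)
      (fun l _ => Finset.sum_nonneg fun k _ => by positivity) (Finset.mem_univ l)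
  rw [ht]
  calc ‖(Cᴴ * C) i j‖ ≤ ∑ k, (‖C k i‖ ^ 2 + ‖C k j‖ ^ 2) / 2 := by
        refine (norm_sum_le _ _).trans (Finset.sum_le_sum fun k _ => ?_)
        have e : ‖Cᴴ i k * C k j‖ = ‖C k i‖ * ‖C k j‖ := by
          rw [norm_mul, conjTranspose_apply, norm_star]
        refine e.le.trans ?_
        nlinarith [sq_nonneg (‖C k i‖ - ‖C k j‖)]
    _ = ((∑ k, ‖C k i‖ ^ 2) + ∑ k, ‖C k j‖ ^ 2) / 2 := by
        rw [← Finset.sum_div, Finset.sum_add_distrib]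
    _ ≤ _ := by linarith [hcol i, hcol j]

/-- The positive semidefinite elements of a subspace with a prescribed trace. -/
def traceSlice (A : Submodule ℂ (Op d)) (α : ℝ) : Set (Op d) :=
  {R | R ∈ A ∧ R.PosSemidef ∧ R.trace = α}

theorem isCompact_traceSlice (A : Submodule ℂ (Op d)) (α : ℝ) : IsCompact (traceSlice A α) := by
  have hc : IsClosed (traceSlice A α) :=
    (A.closed_of_finiteDimensional).inter
      (isClosed_posSemidef.inter (isClosed_eq (by fun_prop) continuous_const))
  have hK : IsCompact {R : Op d | ∀ i j, R i j ∈ Metric.closedBall (0 : ℂ) α} :=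
    isCompact_pi_infinite fun i => isCompact_pi_infinite fun j => isCompact_closedBall _ _
  refine hK.of_isClosed_subset hc fun R hR i j => ?_
  have := hR.2.1.norm_apply_le i j
  rw [hR.2.2] at this
  simpa using this

/-- If no element of `A` with trace `τ` dominates `Q`, a hyperplane separates them; its normal vector is
positive semidefinite and orthogonal to the traceless elements of `A`. -/
theorem exists_separating {A : Submodule ℂ (Op d)} (h1 : (1 : Op d) ∈ A)
    (hstar : ∀ R ∈ A, Rᴴ ∈ A) [Nonempty d] {Q : Op d} (hQ : Q.IsHermitian) {τ : ℝ}
    (hno : ∀ R ∈ A, R.trace = τ → ¬ (R - Q).PosSemidef) :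
    ∃ T : Op d, T.PosSemidef ∧ T.trace ≠ 0 ∧ (∀ R ∈ A, R.trace = 0 → (R * T).trace = 0) ∧
      τ / Fintype.card d * T.trace.re ≤ (Q * T).trace.re := by
  -- Only the Hermitian part of `M` is constrained, so `O` is open among all matrices and invariant
  -- under skew-Hermitian translations, which later makes the normal vector Hermitian. The slack `δ`
  -- gives openness.
  set O : Set (Op d) :=
    {M | ∃ δ : ℝ, 0 < δ ∧ (M + Mᴴ - (2 : ℂ) • Q - (δ : ℂ) • (1 : Op d)).PosSemidef} with hO
  set V : Set (Op d) := {R | R ∈ A ∧ R.trace = τ} with hV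
  have hOc : Convex ℝ O := by
    rintro M ⟨δ, hδ, hM⟩ M' ⟨δ', hδ', hM'⟩ a b ha hb hab
    refine ⟨a * δ + b * δ', ?_, ?_⟩
    · rcases ha.eq_or_lt with rfl | ha
      · rw [zero_add] at hab; subst hab; simpa using hδ'
      · positivity
    · have := (hM.smul (a := (a : ℂ)) (by exact_mod_cast ha)).add
        (hM'.smul (a := (b : ℂ)) (by exact_mod_cast hb))
      convert this using 1
      have hab' : (2 : ℂ) • Q = ((a : ℂ) + b) • ((2 : ℂ) • Q) := by
        rw [← Complex.ofReal_add, hab, Complex.ofReal_one, one_smul]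
      nth_rewrite 1 [hab']
      simp only [conjTranspose_add, ← Complex.coe_smul, conjTranspose_smul, RCLike.star_def,
        Complex.conj_ofReal]
      push_cast
      module
  have hOo : IsOpen O := by
    rw [isOpen_iff_mem_nhds]
    rintro M ⟨δ, hδ, hM⟩
    have h := eventually_posSemidef_add (d := d) (half_pos hδ)
    have ht : Tendsto (fun N : Op d => N - M) (𝓝 M) (𝓝 0) := by
      have : Continuous fun N : Op d => N - M := by fun_prop
      simpa using this.tendsto M
    filter_upwards [ht.eventually h] with N hN
    refine ⟨δ / 2, half_pos hδ, ?_⟩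
    convert hM.add hN using 1
    rw [conjTranspose_sub]
    push_cast
    module
  have hVc : Convex ℝ V := by
    rintro M ⟨hM, hMt⟩ M' ⟨hM', hMt'⟩ a b _ _ hab
    refine ⟨?_, ?_⟩
    · rw [← Complex.coe_smul, ← Complex.coe_smul]
      exact A.add_mem (A.smul_mem _ hM) (A.smul_mem _ hM')
    · rw [← Complex.coe_smul, ← Complex.coe_smul, trace_add, trace_smul, trace_smul, hMt, hMt',
        ← add_smul, ← Complex.ofReal_add, hab]
      simp
  have hdisj : Disjoint O V := by
    rw [Set.disjoint_left]
    rintro R ⟨δ, hδ, hR⟩ ⟨hRA, hRt⟩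
    -- The Hermitian part stays in `A` and, `τ` being real, keeps the trace `τ`.
    refine hno ((1 / 2 : ℂ) • (R + Rᴴ)) (A.smul_mem _ (A.add_mem hRA (hstar _ hRA))) ?_ ?_
    · rw [trace_smul, trace_add, trace_conjTranspose, hRt, RCLike.star_def, Complex.conj_ofReal,
        smul_eq_mul]
      ring
    · have h2 : ((δ : ℂ) • (1 : Op d)).PosSemidef :=
        PosSemidef.one.smul (by exact_mod_cast hδ.le)
      convert (hR.add h2).smul (a := (1 / 2 : ℂ)) (by rw [Complex.nonneg_iff]; norm_num) using 1
      module
  obtain ⟨f, u, hfO, hfV⟩ := RCLike.geometric_hahn_banach_open (𝕜 := ℂ) hOc hOo hVc hdisj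
  -- the representing matrix
  set T : Op d := Matrix.of fun i j => - f (Matrix.single j i 1) with hT
  have hfT : ∀ N : Op d, f N = - (N * T).trace := by
    intro N
    conv_lhs => rw [Matrix.matrix_eq_sum_single N]
    simp only [Matrix.trace, Matrix.diag, Matrix.mul_apply, map_sum, hT, Matrix.of_apply, mul_neg,
      Finset.sum_neg_distrib, neg_neg]
    refine Finset.sum_congr rfl fun i _ => Finset.sum_congr rfl fun j _ => ?_
    rw [← smul_eq_mul, ← map_smul, Matrix.smul_single, smul_eq_mul, mul_one]
  have hmem : ∀ (P N : Op d) (ε : ℝ), P.PosSemidef → N + Nᴴ = 0 → 0 < ε →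
      Q + P + N + (ε : ℂ) • 1 ∈ O := by
    intro P N ε hP hN hε
    refine ⟨2 * ε, by positivity, ?_⟩
    convert hP.add hP using 1
    have hN' : Nᴴ = - N := by rw [eq_neg_iff_add_eq_zero, add_comm, hN]
    simp only [conjTranspose_add, conjTranspose_smul, RCLike.star_def, Complex.conj_ofReal, hQ.eq,
      hP.1.eq, hN', conjTranspose_one]
    push_cast
    module
  have hbound : ∀ (P N : Op d), P.PosSemidef → N + Nᴴ = 0 →
      -u - (Q * T).trace.re - T.trace.re < (P * T).trace.re + (N * T).trace.re := by
    intro P N hP hN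
    have := hfO _ (hmem P N 1 hP hN one_pos)
    rw [hfT] at this
    simp [add_mul, trace_add] at this
    linarith
  -- A linear function of `t` bounded below for all `t > 0` has nonnegative slope. Every sign
  -- condition on `T` follows from this by moving along a ray inside `O` or `V`.
  have hscale : ∀ x C : ℝ, (∀ t : ℝ, 0 < t → C < t * x) → 0 ≤ x := by
    intro x C h
    by_contra! hx
    have h1 := h ((|C| + 1) / (-x)) (by have := abs_nonneg C; apply div_pos <;> linarith)
    have h2 : (|C| + 1) / (-x) * x = -(|C| + 1) := by
      have := hx.ne
      field_simp
    rw [h2] at h1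
    linarith [neg_abs_le C]
  have hpos : ∀ P : Op d, P.PosSemidef → 0 ≤ (P * T).trace.re := by
    intro P hP
    refine hscale _ (-u - (Q * T).trace.re - T.trace.re) fun t ht => ?_
    have := hbound ((t : ℂ) • P) 0 (hP.smul (by exact_mod_cast ht.le)) (by simp)
    simpa using this
  have hskew0 : ∀ N : Op d, N + Nᴴ = 0 → 0 ≤ (N * T).trace.re := by
    intro N hN
    refine hscale _ (-u - (Q * T).trace.re - T.trace.re) fun t ht => ?_
    have := hbound 0 ((t : ℂ) • N) PosSemidef.zero (by
      rw [conjTranspose_smul, RCLike.star_def, Complex.conj_ofReal, ← smul_add, hN, smul_zero])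
    simpa using this
  have hskew : ∀ N : Op d, N + Nᴴ = 0 → (N * T).trace.re = 0 := by
    intro N hN
    refine le_antisymm ?_ (hskew0 N hN)
    have := hskew0 (-N) (by rw [conjTranspose_neg, ← neg_add, hN, neg_zero])
    simp at this
    linarith
  -- `T` pairs to real part zero with skew-Hermitian matrices, so `tr (M (T - Tᴴ))` has real part
  -- zero for all `M`; the choice `M = (T - Tᴴ)ᴴ` gives `T = Tᴴ`.
  have hTh : T.IsHermitian := by
    have h0 : ∀ M : Op d, (M * (T - Tᴴ)).trace.re = 0 := by
      intro M
      have h := hskew (M - Mᴴ) (by rw [conjTranspose_sub, conjTranspose_conjTranspose]; abel)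
      have e : (M * Tᴴ).trace.re = (Mᴴ * T).trace.re := by
        rw [← trace_mul_comm, ← Complex.conj_re, ← RCLike.star_def, ← trace_conjTranspose,
          conjTranspose_mul, conjTranspose_conjTranspose]
      rw [mul_sub, trace_sub, Complex.sub_re, e, ← Complex.sub_re, ← trace_sub, ← sub_mul, h]
    have h1 := h0 (T - Tᴴ)ᴴ
    have h2 := (posSemidef_conjTranspose_mul_self (T - Tᴴ)).trace_nonneg
    have h3 : ((T - Tᴴ)ᴴ * (T - Tᴴ)).trace = 0 :=
      Complex.ext h1 (by simpa using ((Complex.nonneg_iff.1 h2).2).symm)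
    rw [trace_conjTranspose_mul_self_eq_zero_iff, sub_eq_zero] at h3
    exact h3.symm
  have hTp : T.PosSemidef := by
    refine PosSemidef.of_dotProduct_mulVec_nonneg hTh fun x => ?_
    have e : star x ⬝ᵥ (T *ᵥ x) = (vecMulVec x (star x) * T).trace := by
      rw [vecMulVec_mul, trace_vecMulVec, dotProduct_mulVec, dotProduct_comm]
    have him : star (star x ⬝ᵥ (T *ᵥ x)) = star x ⬝ᵥ (T *ᵥ x) := by
      rw [← star_dotProduct, star_mulVec, hTh.eq, ← dotProduct_mulVec]
    rw [Complex.nonneg_iff]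
    refine ⟨?_, (Complex.conj_eq_iff_im.1 him).symm⟩
    rw [e]
    exact hpos _ (posSemidef_vecMulVec_self_star x)
  have hcard : (Fintype.card d : ℂ) ≠ 0 := by exact_mod_cast Fintype.card_ne_zero
  -- The multiple of the identity with trace `τ` is a base point: `V` is `v` plus the traceless part
  -- of `A`.
  obtain ⟨v, hv⟩ : ∃ v : Op d, v = ((τ / Fintype.card d : ℝ) : ℂ) • 1 := ⟨_, rfl⟩
  have hvV : ∀ N ∈ A, N.trace = 0 → v + N ∈ V := by
    intro N hN hNt
    refine ⟨A.add_mem (hv ▸ A.smul_mem _ h1) hN, ?_⟩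
    rw [hv, trace_add, hNt, trace_smul, trace_one, smul_eq_mul, add_zero]
    push_cast
    field_simp
  have horth0 : ∀ N ∈ A, N.trace = 0 → 0 ≤ - (N * T).trace.re := by
    intro N hN hNt
    refine hscale _ (u - 1 + (v * T).trace.re) fun t ht => ?_
    have := hfV _ (hvV ((t : ℂ) • N) (A.smul_mem _ hN) (by rw [trace_smul, hNt, smul_zero]))
    rw [hfT, add_mul, smul_mul, trace_add, trace_smul] at this
    simp at this
    linarith
  have horth1 : ∀ N ∈ A, N.trace = 0 → (N * T).trace.re = 0 := by
    intro N hN hNt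
    have h2 := horth0 N hN hNt
    have h3 := horth0 (-N) (A.neg_mem hN) (by simp [hNt])
    simp at h3
    linarith
  have hfv : u ≤ -(v * T).trace.re := by
    have := hfV _ (hvV 0 A.zero_mem (by simp))
    rw [hfT] at this
    simpa using this
  have hfQ : ∀ ε : ℝ, 0 < ε → -(Q * T).trace.re - ε * T.trace.re < u := by
    intro ε hε
    have := hfO _ (hmem 0 0 ε PosSemidef.zero (by simp) hε)
    rw [hfT] at this
    simp [add_mul] at this
    linarith
  -- A positive semidefinite `T` of trace zero vanishes, and the strict separation then reads `0 < u
  -- ≤ 0`. For orthogonality, the imaginary part of the pairing is recovered from `Complex.I • N`.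
  refine ⟨T, hTp, fun h0 => ?_, fun N hN hNt => ?_, ?_⟩
  · rw [hTp.trace_eq_zero_iff] at h0
    have h2 := hfQ 1 one_pos
    rw [h0] at h2 hfv
    simp at h2 hfv
    linarith
  · refine Complex.ext (horth1 N hN hNt) ?_
    have := horth1 (Complex.I • N) (A.smul_mem _ hN) (by rw [trace_smul, hNt, smul_zero])
    simpa using this
  · have hvT : (v * T).trace.re = τ / Fintype.card d * T.trace.re := by
      rw [hv, smul_mul, one_mul, trace_smul, smul_eq_mul, Complex.re_ofReal_mul]
    rw [← hvT]
    have hTn : 0 ≤ T.trace.re := (Complex.nonneg_iff.1 hTp.trace_nonneg).1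
    refine le_of_forall_pos_le_add fun ε hε => ?_
    have h2 := hfQ (ε / (T.trace.re + 1)) (by positivity)
    have h3 : ε / (T.trace.re + 1) * T.trace.re ≤ ε := by
      rw [div_mul_eq_mul_div, div_le_iff₀ (by positivity)]
      nlinarith
    linarith

theorem trace_mul_nonneg {P T : Op d} (hP : P.PosSemidef) (hT : T.PosSemidef) :
    0 ≤ (P * T).trace.re := by
  obtain ⟨C, rfl⟩ : ∃ C : Op d, T = Cᴴ * C := by
    open scoped MatrixOrder in
    exact CStarAlgebra.nonneg_iff_eq_star_mul_self.1 (nonneg_iff_posSemidef.2 hT)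
  rw [← Matrix.mul_assoc, trace_mul_comm, ← Matrix.mul_assoc]
  exact (Complex.nonneg_iff.1 (hP.mul_mul_conjTranspose_same C).trace_nonneg).1

/-- Strong duality: if the orthogonal complement of the traceless part of `A` is in `B`, and `A`, `B` pair as multiples of their traces, then maximising `Q` over the normalized positive semidefinite elements
of `B` amounts to finding the least multiple of a normalized element of `A` that dominates `Q`. -/
theorem exists_isGreatest_isLeast [Nonempty d] {A B : Submodule ℂ (Op d)} {α β : ℝ}
    (hα : 0 < α) (hβ : 0 < β) (hαβ : α * β = Fintype.card d)
    (h1A : (1 : Op d) ∈ A) (h1B : (1 : Op d) ∈ B) (hstar : ∀ R ∈ A, Rᴴ ∈ A)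
    (hpair : ∀ R ∈ A, ∀ T ∈ B, Fintype.card d * (R * T).trace = R.trace * T.trace)
    (horth : ∀ T, (∀ R ∈ A, R.trace = 0 → (R * T).trace = 0) → T ∈ B)
    {Q R₀ : Op d} (hQ : Q.PosSemidef) (hR₀ : R₀ ∈ traceSlice A α) (hQR₀ : (R₀ - Q).PosSemidef) :
    ∃ p : ℝ, IsGreatest {q : ℝ | ∃ T ∈ traceSlice B β, q = (Q * T).trace.re} p ∧
      IsLeast {q : ℝ | q ∈ Set.Icc (0 : ℝ) 1 ∧
        ∃ R ∈ traceSlice A α, ((q : ℂ) • R - Q).PosSemidef} p := by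
  have hcard : (0 : ℝ) < Fintype.card d := by exact_mod_cast Fintype.card_pos
  -- The normalization `α * β = card d` is what makes these pairings equal to `1`; weak duality
  -- follows.
  have hpair1 : ∀ R ∈ traceSlice A α, ∀ T ∈ traceSlice B β, (R * T).trace.re = 1 := by
    intro R hR T hT
    have h := hpair R hR.1 T hT.1
    rw [hR.2.2, hT.2.2, ← Complex.ofReal_mul, hαβ, Complex.ofReal_natCast] at h
    have h2 : (Fintype.card d : ℂ) ≠ 0 := by exact_mod_cast Fintype.card_ne_zero
    rw [mul_right_eq_self₀.1 h |>.resolve_right h2]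
    simp
  have hweak : ∀ q : ℝ, ∀ R ∈ traceSlice A α, ((q : ℂ) • R - Q).PosSemidef →
      ∀ T ∈ traceSlice B β, (Q * T).trace.re ≤ q := by
    intro q R hR hq T hT
    have h := trace_mul_nonneg hq hT.2.1
    rw [sub_mul, Matrix.smul_mul, trace_sub, trace_smul, smul_eq_mul, Complex.sub_re,
      Complex.re_ofReal_mul, hpair1 R hR T hT] at h
    linarith
  have hne : (traceSlice B β).Nonempty := by
    refine ⟨((β / Fintype.card d : ℝ) : ℂ) • 1, B.smul_mem _ h1B,
      PosSemidef.one.smul (by exact_mod_cast (div_pos hβ hcard).le), ?_⟩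
    rw [trace_smul, trace_one, smul_eq_mul]
    push_cast
    have h2 : (Fintype.card d : ℂ) ≠ 0 := by exact_mod_cast Fintype.card_ne_zero
    field_simp
  obtain ⟨T₀, hT₀, hmax⟩ := (isCompact_traceSlice B β).exists_isMaxOn hne
    (f := fun T => (Q * T).trace.re) (by fun_prop)
  set p := (Q * T₀).trace.re with hp
  have hp0 : 0 ≤ p := trace_mul_nonneg hQ hT₀.2.1
  have hp1 : p ≤ 1 := hweak 1 R₀ hR₀ (by simpa using hQR₀) T₀ hT₀
  -- If `q` were infeasible, separation at trace `q * α` would give a normal vector which, scaled to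
  -- trace `β`, is a competitor of value at least `q > p`.
  have hstrict : ∀ q : ℝ, p < q → ∃ R ∈ traceSlice A α, ((q : ℂ) • R - Q).PosSemidef := by
    intro q hq
    have hq0 : 0 < q := hp0.trans_lt hq
    by_contra! hno
    obtain ⟨T, hTp, hTt, hTo, hTq⟩ := exists_separating (τ := q * α) h1A hstar hQ.1 (by
      intro R hRA hRt hRQ
      refine hno (((q⁻¹ : ℝ) : ℂ) • R) ⟨A.smul_mem _ hRA, ?_, ?_⟩ ?_
      · have : R.PosSemidef := by simpa using hRQ.add hQ
        exact this.smul (by exact_mod_cast (inv_pos.2 hq0).le)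
      · rw [trace_smul, hRt, smul_eq_mul, ← Complex.ofReal_mul, inv_mul_cancel_left₀ hq0.ne']
      · rw [smul_smul, ← Complex.ofReal_mul, mul_inv_cancel₀ hq0.ne']
        simpa using hRQ)
    have hTB := horth T hTo
    have hTn := Complex.nonneg_iff.1 hTp.trace_nonneg
    have hTre : (T.trace.re : ℂ) = T.trace := Complex.ext rfl (by simpa using hTn.2)
    have hTpos : 0 < T.trace.re := by
      refine lt_of_le_of_ne hTn.1 fun h => hTt ?_
      rw [← hTre, ← h, Complex.ofReal_zero]
    have hmem : ((β / T.trace.re : ℝ) : ℂ) • T ∈ traceSlice B β := by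
      refine ⟨B.smul_mem _ hTB, hTp.smul (by exact_mod_cast (div_pos hβ hTpos).le), ?_⟩
      rw [trace_smul, smul_eq_mul]
      nth_rewrite 2 [← hTre]
      rw [← Complex.ofReal_mul, div_mul_cancel₀ _ hTpos.ne']
    have h3 : (Q * (((β / T.trace.re : ℝ) : ℂ) • T)).trace.re ≤ p := hmax hmem
    rw [Matrix.mul_smul, trace_smul, smul_eq_mul, Complex.re_ofReal_mul] at h3
    have h4 : q ≤ β / T.trace.re * (Q * T).trace.re := by
      calc q = β / T.trace.re * (q * α / Fintype.card d * T.trace.re) := by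
            rw [← hαβ]; field_simp
        _ ≤ _ := mul_le_mul_of_nonneg_left hTq (div_pos hβ hTpos).le
    linarith
  -- The bound is `2` and not `1` because `p` is approached from above and may equal `1`.
  have hclosed : IsClosed {q : ℝ | q ∈ Set.Icc 0 2 ∧
      ∃ R ∈ traceSlice A α, ((q : ℂ) • R - Q).PosSemidef} := by
    have hK : IsCompact ((Set.Icc (0 : ℝ) 2 ×ˢ traceSlice A α) ∩
        {x : ℝ × Op d | ((x.1 : ℂ) • x.2 - Q).PosSemidef}) :=
      (isCompact_Icc.prod (isCompact_traceSlice A α)).inter_right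
        (isClosed_posSemidef.preimage (by fun_prop))
    convert (hK.image continuous_fst).isClosed using 1
    ext q
    constructor
    · rintro ⟨hq, R, hR, h⟩
      exact ⟨(q, R), ⟨⟨hq, hR⟩, h⟩, rfl⟩
    · rintro ⟨⟨q, R⟩, ⟨⟨hq, hR⟩, h⟩, rfl⟩
      exact ⟨hq, R, hR, h⟩
  have hpmem : ∃ R ∈ traceSlice A α, ((p : ℂ) • R - Q).PosSemidef := by
    refine (hclosed.mem_of_tendsto (b := 𝓝[>] p) (f := id)
      (tendsto_id.mono_left nhdsWithin_le_nhds) ?_).2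
    filter_upwards [Ioo_mem_nhdsGT (show p < 2 by linarith)] with q hq
    exact ⟨⟨hp0.trans hq.1.le, hq.2.le⟩, hstrict q hq.1⟩
  refine ⟨p, ⟨⟨T₀, hT₀, rfl⟩, ?_⟩, ⟨⟨hp0, hp1⟩, hpmem⟩, ?_⟩
  · rintro q ⟨T, hT, rfl⟩
    exact hmax hT
  · rintro q ⟨_, R, hR, h⟩
    exact hweak q R hR h T₀ hT₀

end Duality

/-! ### The linear constraints on representations -/

section Padding

open Matrix

variable {I c y : Type*} [Fintype I] [Fintype c] [Fintype y] [DecidableEq I] [DecidableEq c]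
  [DecidableEq y]

/-- Partial trace over the factor `y` of a space identified with `c ⊗ y`. -/
def ptr (e : I ≃ c × y) : SuperOp I c := partialTrace y ∘ₗ relabel e

/-- The operator `A ⊗ 1` on a space identified with `c ⊗ y`. -/
def pad (e : I ≃ c × y) : SuperOp c I := relabel e.symm ∘ₗ appendState c (1 : Op y)

omit [Fintype I] [Fintype c] [DecidableEq I] [DecidableEq c] [DecidableEq y] in
theorem ptr_apply (e : I ≃ c × y) (A : Op I) (i j : c) :
    ptr e A i j = ∑ k, A (e.symm (i, k)) (e.symm (j, k)) := rfl

omit [Fintype I] [Fintype c] [Fintype y] [DecidableEq I] [DecidableEq c] in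
theorem pad_apply (e : I ≃ c × y) (A : Op c) (i j : I) :
    pad e A i j = if (e i).2 = (e j).2 then A (e i).1 (e j).1 else 0 := by
  change A (e i).1 (e j).1 * (1 : Op y) (e i).2 (e j).2 = _
  rw [Matrix.one_apply, mul_ite, mul_one, mul_zero]

omit [Fintype I] [Fintype c] [DecidableEq I] [DecidableEq c] in
theorem ptr_pad (e : I ≃ c × y) (A : Op c) : ptr e (pad e A) = (Fintype.card y : ℂ) • A := by
  ext i j
  simp [ptr_apply, pad_apply]

omit [DecidableEq I] [DecidableEq c] [DecidableEq y] in
theorem trace_ptr (e : I ≃ c × y) (A : Op I) : (ptr e A).trace = A.trace := by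
  simp only [Matrix.trace, Matrix.diag, ptr_apply]
  rw [← Fintype.sum_prod_type' (f := fun i k => A (e.symm (i, k)) (e.symm (i, k)))]
  exact e.symm.sum_comp fun i => A i i

omit [DecidableEq I] [DecidableEq c] in
-- The adjointness of padding and partial trace, from which the duality of the constraint spaces
-- follows formally.
theorem trace_pad_mul (e : I ≃ c × y) (A : Op c) (B : Op I) :
    (pad e A * B).trace = (A * ptr e B).trace := by
  simp only [Matrix.trace, Matrix.diag, Matrix.mul_apply]
  rw [← Equiv.sum_comp e.symm, Fintype.sum_prod_type]
  refine Finset.sum_congr rfl fun i _ => ?_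
  simp only [ptr_apply, Finset.mul_sum]
  refine Eq.trans ?_ Finset.sum_comm
  refine Finset.sum_congr rfl fun k _ => ?_
  rw [← Equiv.sum_comp e.symm, Fintype.sum_prod_type]
  refine Finset.sum_congr rfl fun j _ => ?_
  simp [pad_apply]

omit [DecidableEq I] [DecidableEq c] in
theorem trace_mul_pad (e : I ≃ c × y) (A : Op c) (B : Op I) :
    (B * pad e A).trace = (ptr e B * A).trace := by
  rw [trace_mul_comm, trace_pad_mul, trace_mul_comm]

omit [DecidableEq I] [DecidableEq c] in
theorem trace_pad (e : I ≃ c × y) (A : Op c) : (pad e A).trace = Fintype.card y * A.trace := by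
  rw [← trace_ptr e, ptr_pad, trace_smul, smul_eq_mul]

omit [Fintype I] [Fintype c] [DecidableEq I] [DecidableEq c] [DecidableEq y] in
theorem ptr_conjTranspose (e : I ≃ c × y) (A : Op I) : ptr e Aᴴ = (ptr e A)ᴴ := by
  ext i j
  simp [ptr_apply]

omit [Fintype I] [Fintype c] [Fintype y] [DecidableEq I] [DecidableEq c] in
theorem pad_conjTranspose (e : I ≃ c × y) (A : Op c) : pad e Aᴴ = (pad e A)ᴴ := by
  ext i j
  simp only [pad_apply, conjTranspose_apply, eq_comm (a := (e j).2)]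
  split_ifs <;> simp

omit [Fintype I] [Fintype c] [Fintype y] in
theorem pad_one (e : I ≃ c × y) : pad e (1 : Op c) = 1 := by
  ext i j
  rw [pad_apply, Matrix.one_apply, Matrix.one_apply, ← ite_and]
  refine if_congr ?_ rfl rfl
  rw [and_comm, ← Prod.ext_iff, e.apply_eq_iff_eq]

omit [Fintype I] [Fintype c] in
theorem ptr_one (e : I ≃ c × y) : ptr e (1 : Op I) = (Fintype.card y : ℂ) • 1 := by
  rw [← pad_one e, ptr_pad]

omit [DecidableEq I] [DecidableEq c] in
-- The complement of the kernel of `ptr e` is the range of `pad e`. Any `M` minus its padded,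
-- averaged partial trace is in the kernel, and adjointness moves the averaging onto `T`.
theorem eq_pad_of_orthogonal [Nonempty y] (e : I ≃ c × y) {T : Op I}
    (h : ∀ N, ptr e N = 0 → (N * T).trace = 0) :
    T = pad e ((Fintype.card y : ℂ)⁻¹ • ptr e T) := by
  classical
  have hy : (Fintype.card y : ℂ) ≠ 0 := by exact_mod_cast Fintype.card_ne_zero
  refine Matrix.ext_iff_trace_mul_left.2 fun M => ?_
  have h1 := h (M - pad e ((Fintype.card y : ℂ)⁻¹ • ptr e M)) (by
    rw [map_sub, ptr_pad, smul_smul, mul_inv_cancel₀ hy, one_smul, sub_self])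
  rw [sub_mul, trace_sub, trace_pad_mul, Matrix.smul_mul, trace_smul, ← trace_mul_pad] at h1
  rw [map_smul, Matrix.mul_smul, trace_smul]
  exact sub_eq_zero.1 h1

end Padding

/-! ### Duality of the constraint subspaces -/

section DualPair

open Matrix

/-- Two subspaces of operators that are, up to the identity operator, orthogonal complements. -/
structure DualPair {I : Type*} [Fintype I] [DecidableEq I] (A B : Submodule ℂ (Op I)) : Prop where
  one_left : (1 : Op I) ∈ A
  one_right : (1 : Op I) ∈ B
  star_left : ∀ R ∈ A, Rᴴ ∈ A
  star_right : ∀ T ∈ B, Tᴴ ∈ B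
  pairing : ∀ R ∈ A, ∀ T ∈ B, Fintype.card I * (R * T).trace = R.trace * T.trace
  orth_left : ∀ T, (∀ R ∈ A, R.trace = 0 → (R * T).trace = 0) → T ∈ B
  orth_right : ∀ R, (∀ T ∈ B, T.trace = 0 → (T * R).trace = 0) → R ∈ A

variable {I J M x y : Type*} [Fintype I] [Fintype J] [Fintype M] [Fintype x] [Fintype y]
  [DecidableEq I] [DecidableEq J] [DecidableEq M] [DecidableEq x] [DecidableEq y]

theorem DualPair.symm {A B : Submodule ℂ (Op I)} (h : DualPair A B) : DualPair B A where
  one_left := h.one_right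
  one_right := h.one_left
  star_left := h.star_right
  star_right := h.star_left
  pairing R hR T hT := by rw [trace_mul_comm, h.pairing T hT R hR, mul_comm]
  orth_left := h.orth_right
  orth_right := h.orth_left

theorem DualPair.top [Subsingleton I] [Nonempty I] :
    DualPair (⊤ : Submodule ℂ (Op I)) ⊤ where
  one_left := trivial
  one_right := trivial
  star_left _ _ := trivial
  star_right _ _ := trivial
  pairing R _ T _ := by
    obtain ⟨i⟩ := ‹Nonempty I›
    have : Unique I := ⟨⟨i⟩, fun _ => Subsingleton.elim _ _⟩
    simp [Matrix.trace, Matrix.mul_apply]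
  orth_left _ _ := trivial
  orth_right _ _ := trivial

/-- Operators whose partial trace over an output `y` ignores the last input `x`, the rest being in
`A`. -/
def extendLeft (e : I ≃ M × y) (f : M ≃ J × x) (A : Submodule ℂ (Op J)) : Submodule ℂ (Op I) :=
  (A.map (pad f)).comap (ptr e)

/-- Operators that ignore the factor `y` and whose partial trace over `x` is in `B`. -/
def extendRight (e : I ≃ M × y) (f : M ≃ J × x) (B : Submodule ℂ (Op J)) : Submodule ℂ (Op I) :=
  (B.comap (ptr f)).map (pad e)

/-- Adjointness carries each condition down to `J`. For the complements, test operators in the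
kernel of a partial trace first force a padded form; doubly padded elements then test the remaining
factor against the smaller pair. -/
theorem DualPair.extend [Nonempty x] [Nonempty y] (e : I ≃ M × y) (f : M ≃ J × x)
    {A B : Submodule ℂ (Op J)} (h : DualPair A B) :
    DualPair (extendLeft e f A) (extendRight e f B) := by
  have hx : (Fintype.card x : ℂ) ≠ 0 := by exact_mod_cast Fintype.card_ne_zero
  have hy : (Fintype.card y : ℂ) ≠ 0 := by exact_mod_cast Fintype.card_ne_zero
  refine ⟨?_, ?_, ?_, ?_, ?_, ?_, ?_⟩
  · exact ⟨(Fintype.card y : ℂ) • 1, A.smul_mem _ h.one_left, by rw [map_smul, pad_one, ptr_one]⟩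
  · exact ⟨1, by
      change ptr f 1 ∈ B
      rw [ptr_one]
      exact B.smul_mem _ h.one_right, pad_one e⟩
  · rintro R ⟨R', hR', h1⟩
    exact ⟨R'ᴴ, h.star_left _ hR', by rw [pad_conjTranspose, h1, ptr_conjTranspose]⟩
  · rintro T ⟨T', hT', rfl⟩
    exact ⟨T'ᴴ, by
      change ptr f T'ᴴ ∈ B
      rw [ptr_conjTranspose]
      exact h.star_right _ hT', pad_conjTranspose e T'⟩
  · rintro R ⟨R', hR', h1⟩ T ⟨T', hT', rfl⟩
    have hI : (Fintype.card I : ℂ) = Fintype.card J * Fintype.card x * Fintype.card y := by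
      rw [Fintype.card_congr e, Fintype.card_prod, Fintype.card_congr f, Fintype.card_prod]
      push_cast
      ring
    have h2 := h.pairing R' hR' _ hT'
    rw [trace_mul_pad, ← h1, trace_pad_mul, ← trace_ptr e R, ← h1, trace_pad, trace_pad,
      ← trace_ptr f T', hI]
    linear_combination (Fintype.card x * Fintype.card y : ℂ) * h2
  · intro T hT
    have hpad := eq_pad_of_orthogonal e (T := T) fun N hN =>
      hT N ⟨0, A.zero_mem, by rw [map_zero, hN]⟩ (by rw [← trace_ptr e, hN, trace_zero])
    refine ⟨_, h.orth_left _ fun R hR hRt => ?_, hpad.symm⟩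
    have h3 := hT (pad e (pad f R)) ⟨(Fintype.card y : ℂ) • R, A.smul_mem _ hR, by
      rw [ptr_pad, map_smul]⟩ (by rw [trace_pad, trace_pad, hRt]; simp)
    rw [trace_pad_mul, trace_pad_mul] at h3
    rw [map_smul, Matrix.mul_smul, trace_smul, h3, smul_zero]
  · intro R hR
    have hpad := eq_pad_of_orthogonal f (T := ptr e R) fun N hN => by
      rw [← trace_pad_mul]
      exact hR _ ⟨N, by
        change ptr f N ∈ B
        rw [hN]
        exact B.zero_mem, rfl⟩ (by rw [trace_pad, ← trace_ptr f, hN]; simp)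
    refine ⟨_, h.orth_right _ fun T hT hTt => ?_, hpad.symm⟩
    have h3 := hR (pad e (pad f T)) ⟨pad f T, by
      change ptr f (pad f T) ∈ B
      rw [ptr_pad]
      exact B.smul_mem _ hT, rfl⟩ (by rw [trace_pad, trace_pad, hTt]; simp)
    rw [trace_pad_mul, trace_pad_mul] at h3
    rw [Matrix.mul_smul, trace_smul, h3, smul_zero]

end DualPair

section Constraints

variable (X Y : ℕ → Type u)

instance Tens.nonempty (X : ℕ → Type u) [∀ k, Nonempty (X k)] : ∀ k, Nonempty (Tens X k)
  | 0 => inferInstanceAs (Nonempty PUnit)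
  | k + 1 =>
    letI := Tens.nonempty X k
    inferInstanceAs (Nonempty (Tens X k × X k))

/-- Splitting off the last output space. -/
def splitOutput (n : ℕ) :
    Tens Y (n + 1) × Tens X (n + 1) ≃ (Tens Y n × Tens X (n + 1)) × Y n where
  toFun i := ((i.1.1, i.2), i.1.2)
  invFun i := ((i.1.1, i.2), i.1.2)
  left_inv _ := rfl
  right_inv _ := rfl

/-- Splitting off the last input space. -/
def splitInput (n : ℕ) : Tens Y n × Tens X (n + 1) ≃ (Tens Y n × Tens X n) × X n where
  toFun i := ((i.1, i.2.1), i.2.2)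
  invFun i := (i.1.1, (i.1.2, i.2))
  left_inv _ := rfl
  right_inv _ := rfl

variable [∀ k, Fintype (X k)] [∀ k, DecidableEq (X k)] [∀ k, Fintype (Y k)] [∀ k, DecidableEq (Y k)]

/-- The subspace cut out by the linear constraints on representations of strategies. -/
def strategySpace : ∀ n, Submodule ℂ (Op (Tens Y n × Tens X n))
  | 0 => ⊤
  | n + 1 => extendLeft (splitOutput X Y n) (splitInput X Y n) (strategySpace n)

/-- The subspace cut out by the linear constraints on representations of co-strategies. -/
def coStrategySpace : ∀ n, Submodule ℂ (Op (Tens Y n × Tens X n))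
  | 0 => ⊤
  | n + 1 => extendRight (splitOutput X Y n) (splitInput X Y n) (coStrategySpace n)

theorem dualPair_strategySpace [∀ k, Nonempty (X k)] [∀ k, Nonempty (Y k)] :
    ∀ n, DualPair (strategySpace X Y n) (coStrategySpace X Y n)
  | 0 => by
    have : Subsingleton (Tens Y 0 × Tens X 0) := inferInstanceAs (Subsingleton (PUnit × PUnit))
    exact DualPair.top
  | n + 1 => (dualPair_strategySpace n).extend _ _

end Constraints

/-! ### Choi operators -/

section Choi

open Matrix

variable {a b c o x z : Type*} [Fintype a] [DecidableEq a]

theorem choi_apply (Φ : SuperOp a b) (j j' : b) (i i' : a) :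
    choi Φ (j, i) (j', i') = Φ (Matrix.single i i' 1) j j' := by
  simp only [choi, Matrix.sum_apply, kroneckerMap_apply]
  rw [Finset.sum_eq_single i, Finset.sum_eq_single i']
  · simp
  · intro k _ hk
    simp [hk]
  · simp
  · intro k _ hk
    simp [hk]
  · simp

theorem apply_eq_sum_choi (Φ : SuperOp a b) (A : Op a) (j j' : b) :
    Φ A j j' = ∑ i, ∑ i', A i i' * choi Φ (j, i) (j', i') := by
  conv_lhs => rw [Matrix.matrix_eq_sum_single A]
  simp only [map_sum, Matrix.sum_apply, choi_apply]
  refine Finset.sum_congr rfl fun i _ => Finset.sum_congr rfl fun i' _ => ?_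
  have : Matrix.single i i' (A i i') = A i i' • Matrix.single i i' (1 : ℂ) := by
    rw [Matrix.smul_single, smul_eq_mul, mul_one]
  rw [this, map_smul, Matrix.smul_apply, smul_eq_mul]

theorem choi_relabel (e : b ≃ c) (Φ : SuperOp a b) (j j' : c) (i i' : a) :
    choi (relabel e ∘ₗ Φ) (j, i) (j', i') = choi Φ (e.symm j, i) (e.symm j', i') := by
  rw [choi_apply, choi_apply]
  rfl

theorem choi_appendState (τ : Op c) (j j' : a) (k k' : c) (i i' : a) :
    choi (appendState a τ) ((j, k), i) ((j', k'), i') = Matrix.single i i' 1 j j' * τ k k' := by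
  rw [choi_apply]
  rfl

theorem choi_partialTrace [Fintype z] (F : SuperOp a (b × z)) (j j' : b) (i i' : a) :
    choi (partialTrace z ∘ₗ F) (j, i) (j', i') = ∑ k, choi F ((j, k), i) ((j', k), i') := by
  simp only [choi_apply]
  rfl

theorem choi_effect [Fintype b] [DecidableEq b] [Fintype z] (P : Op z) (F : SuperOp a (b × z))
    (j j' : b) (i i' : a) :
    choi (effect P ∘ₗ F) (j, i) (j', i') =
      ∑ k, ∑ l, P k l * choi F ((j, l), i) ((j', k), i') := by
  simp only [choi_apply]
  change ∑ k, (((1 : Op b) ⊗ₖ P) * F (Matrix.single i i' 1)) (j, k) (j', k) = _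
  refine Finset.sum_congr rfl fun k _ => ?_
  rw [Matrix.mul_apply, Fintype.sum_prod_type, Finset.sum_eq_single j]
  · simp
  · intro j₁ _ hj
    simp [Matrix.one_apply_ne hj.symm]
  · simp

/-- Each `x`-block of a matrix unit on `a × x` is a matrix unit or zero, so only the contraction
over the memory survives. -/
theorem choi_feed [Fintype x] [DecidableEq x] [Fintype z] [DecidableEq z]
    (F : SuperOp a (b × z)) (G : SuperOp (x × z) o) (j j' : b) (k k' : o) (i i' : a) (l l' : x) :
    choi (feed F G) ((j, k), (i, l)) ((j', k'), (i', l')) =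
      ∑ s, ∑ s', choi F ((j, s), i) ((j', s'), i') * choi G (k, (l, s)) (k', (l', s')) := by
  rw [choi_apply]
  change G (Matrix.of fun p q => F (Matrix.of fun r t =>
    Matrix.single (i, l) (i', l') (1 : ℂ) (r, p.1) (t, q.1)) (j, p.2) (j', q.2)) k k' = _
  have h : ∀ l₁ l₁' : x, (Matrix.of fun r t =>
      Matrix.single (i, l) (i', l') (1 : ℂ) (r, l₁) (t, l₁')) =
      if l = l₁ ∧ l' = l₁' then Matrix.single i i' (1 : ℂ) else 0 := by
    intro l₁ l₁'
    ext r t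
    by_cases h : l = l₁ ∧ l' = l₁'
    · rw [if_pos h]
      simp [Matrix.single_apply, h.1, h.2]
    · rw [if_neg h]
      simp only [Matrix.of_apply, Matrix.single_apply, Prod.mk.injEq, Matrix.zero_apply,
        ite_eq_right_iff]
      tauto
  rw [apply_eq_sum_choi, Fintype.sum_prod_type, Finset.sum_eq_single l]
  · refine Finset.sum_congr rfl fun s _ => ?_
    rw [Fintype.sum_prod_type, Finset.sum_eq_single l']
    · refine Finset.sum_congr rfl fun s' _ => ?_
      simp [h, choi_apply]
    · intro l₁ _ hl
      simp [h, hl.symm]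
    · simp
  · intro l₁ _ hl
    simp [h, hl.symm]
  · simp

/-- The Choi operator is the image under `Φ ⊗ id` of the unnormalized maximally entangled state,
with `a` enumerated to fit an auxiliary space `Fin d`. -/
theorem SuperOp.CompletelyPositive.posSemidef_choi [Fintype b] {Φ : SuperOp a b}
    (h : Φ.CompletelyPositive) :
    (choi Φ).PosSemidef := by
  set e := Fintype.equivFin a
  set v : a × Fin (Fintype.card a) → ℂ := fun i => if e i.1 = i.2 then 1 else 0 with hv
  have h1 := (h _ _ (posSemidef_vecMulVec_self_star v)).submatrix (Prod.map (id : b → b) e)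
  convert h1 using 1
  ext ⟨j, i⟩ ⟨j', i'⟩
  rw [choi_apply]
  change _ = Φ (Matrix.of fun p q => vecMulVec v (star v) (p, e i) (q, e i')) j j'
  refine congrFun (congrFun (congrArg Φ ?_) j) j'
  ext p q
  simp [vecMulVec_apply, hv, Matrix.single_apply, eq_comm (a := p), eq_comm (a := q), ite_and]
  split_ifs <;> rfl

/-- Summing blocks is conjugation by a matrix of zeros and ones. Contractions over memories below
are block sums of Kronecker or Hadamard products, hence preserve positivity. -/
theorem Matrix.PosSemidef.blockSum [Fintype b] [Fintype z] {M : Op (b × z)} (hM : M.PosSemidef) :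
    (Matrix.of fun i j => ∑ k, ∑ l, M (i, k) (j, l) : Op b).PosSemidef := by
  classical
  convert hM.mul_mul_conjTranspose_same
    (Matrix.of fun (i : b) (p : b × z) => if i = p.1 then (1 : ℂ) else 0) using 1
  ext i j
  simp only [Matrix.mul_apply, Matrix.of_apply, Fintype.sum_prod_type, conjTranspose_apply]
  rw [Finset.sum_comm]
  simp [apply_ite]

theorem posSemidef_choi_feed [Fintype b] [Fintype o] [Fintype x] [DecidableEq x] [Fintype z]
    [DecidableEq z] {F : SuperOp a (b × z)} {G : SuperOp (x × z) o} (hF : (choi F).PosSemidef)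
    (hG : (choi G).PosSemidef) : (choi (feed F G)).PosSemidef := by
  classical
  have h := ((hF.kronecker hG).submatrix
    (fun p : ((b × o) × (a × x)) × z =>
      ((((p.1.1.1, p.2), p.1.2.1), (p.1.1.2, (p.1.2.2, p.2))) :
        ((b × z) × a) × (o × (x × z))))).blockSum
  convert h using 1
  ext ⟨⟨j, k⟩, ⟨i, l⟩⟩ ⟨⟨j', k'⟩, ⟨i', l'⟩⟩
  rw [choi_feed]
  rfl

theorem posSemidef_choi_effect [Fintype b] [DecidableEq b] [Fintype z] {F : SuperOp a (b × z)}
    {P : Op z} (hF : (choi F).PosSemidef) (hP : P.PosSemidef) :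
    (choi (effect P ∘ₗ F)).PosSemidef := by
  classical
  have h := ((hF.submatrix fun p : (b × a) × z => ((p.1.1, p.2), p.1.2)).hadamard
    (hP.transpose.submatrix fun p : (b × a) × z => p.2)).blockSum
  convert h using 1
  ext ⟨j, i⟩ ⟨j', i'⟩
  rw [choi_effect, Finset.sum_comm]
  simp [mul_comm]

theorem posSemidef_choi_relabel [Fintype b] [Fintype c] (e : b ≃ c) {F : SuperOp a b}
    (hF : (choi F).PosSemidef) : (choi (relabel e ∘ₗ F)).PosSemidef := by
  convert hF.submatrix (Prod.map e.symm (id : a → a)) using 1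
  ext ⟨j, i⟩ ⟨j', i'⟩
  rw [choi_relabel]
  rfl

theorem posSemidef_choi_appendState [Fintype c] {τ : Op c} (hτ : τ.PosSemidef) :
    (choi (appendState a τ)).PosSemidef := by
  classical
  set v : a × a → ℂ := fun i => if i.1 = i.2 then 1 else 0 with hv
  have h := ((posSemidef_vecMulVec_self_star v).kronecker hτ).submatrix
    (fun p : (a × c) × a => ((p.1.1, p.2), p.1.2))
  refine (congrArg Matrix.PosSemidef ?_).mpr h
  ext ⟨⟨j, k⟩, i⟩ ⟨⟨j', k'⟩, i'⟩
  rw [choi_appendState]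
  simp [vecMulVec_apply, hv, Matrix.single_apply, eq_comm (a := i), eq_comm (a := i'), ite_and]
  split_ifs <;> rfl

theorem effect_one [Fintype b] [DecidableEq b] [Fintype z] [DecidableEq z] :
    effect (a := b) (1 : Op z) = partialTrace z := by
  ext1 A
  simp [effect]

/-- The super-operator with given Kraus operators. -/
def krausMap {ι : Type*} [Fintype ι] (K : ι → Matrix b a ℂ) : SuperOp a b where
  toFun A := ∑ r, K r * A * (K r)ᴴ
  map_add' A B := by
    simp [Matrix.mul_add, Matrix.add_mul, Finset.sum_add_distrib]
  map_smul' t A := by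
    simp [Finset.smul_sum]

theorem choi_krausMap {ι : Type*} [Fintype ι] (K : ι → Matrix b a ℂ) (j j' : b) (i i' : a) :
    choi (krausMap K) (j, i) (j', i') = ∑ r, K r j i * star (K r j' i') := by
  rw [choi_apply]
  simp [krausMap, Matrix.sum_apply, Matrix.mul_apply, Matrix.single_apply, ite_and]

theorem admissible_krausMap [Fintype b] {ι : Type*} [Fintype ι] (K : ι → Matrix b a ℂ)
    (hK : ∑ r, (K r)ᴴ * K r = 1) : (krausMap K).Admissible := by
  refine ⟨fun d A hA => ?_, fun A => ?_⟩
  · have : (krausMap K).tensorId (Fin d) A =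
        ∑ r, (K r ⊗ₖ (1 : Op (Fin d))) * A * (K r ⊗ₖ (1 : Op (Fin d)))ᴴ := by
      ext ⟨j, s⟩ ⟨j', s'⟩
      change (∑ r, K r * (Matrix.of fun p q => A (p, s) (q, s')) * (K r)ᴴ) j j' = _
      rw [Matrix.sum_apply, Matrix.sum_apply]
      refine Finset.sum_congr rfl fun r _ => ?_
      simp [Matrix.mul_apply, Fintype.sum_prod_type, Matrix.one_apply, apply_ite]
    rw [this]
    exact posSemidef_sum _ fun r _ => hA.mul_mul_conjTranspose_same _
  · change (∑ r, K r * A * (K r)ᴴ).trace = _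
    rw [trace_sum]
    calc ∑ r, (K r * A * (K r)ᴴ).trace = ∑ r, ((K r)ᴴ * K r * A).trace :=
          Finset.sum_congr rfl fun r _ => by rw [trace_mul_comm, Matrix.mul_assoc]
      _ = A.trace := by rw [← trace_sum, ← Matrix.sum_mul, hK, Matrix.one_mul]

end Choi

/-! ### Representations satisfy the linear constraints -/

section TracePreserving

variable {a b o x z : Type*} [Fintype a] [DecidableEq a] [Fintype o]

theorem sum_choi_of_admissible {Φ : SuperOp a o} (h : Φ.Admissible) (i i' : a) :
    ∑ k, choi Φ (k, i) (k, i') = if i = i' then 1 else 0 := by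
  simp only [choi_apply]
  refine (h.2 (Matrix.single i i' 1)).trans ?_
  split_ifs with hi
  · rw [hi, Matrix.trace_single_eq_same]
  · rw [Matrix.trace_single_eq_of_ne _ _ _ hi]

/-- Since `G` preserves the trace, discarding its output discards its inputs: an identity appears on
`x` and the memory is traced out. All causality constraints, for both parties, come from this. -/
theorem sum_choi_feed [Fintype x] [DecidableEq x] [Fintype z] [DecidableEq z]
    (F : SuperOp a (b × z)) {G : SuperOp (x × z) o} (hG : G.Admissible) (j j' : b) (i i' : a)
    (l l' : x) :
    ∑ k, choi (feed F G) ((j, k), (i, l)) ((j', k), (i', l')) =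
      if l = l' then choi (partialTrace z ∘ₗ F) (j, i) (j', i') else 0 := by
  simp only [choi_feed]
  rw [Finset.sum_comm]
  simp only [Finset.sum_comm (s := (Finset.univ : Finset o)), ← Finset.mul_sum,
    sum_choi_of_admissible hG, Prod.mk.injEq, choi_partialTrace]
  split_ifs with h <;> simp [h]

end TracePreserving

section Forward

open Matrix

set_option linter.unusedSectionVars false

variable {n m : ℕ} {X Y : ℕ → Type u}
variable [∀ k, Fintype (X k)] [∀ k, DecidableEq (X k)] [∀ k, Fintype (Y k)] [∀ k, DecidableEq (Y k)]

omit [∀ k, DecidableEq (X k)] in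
theorem card_tens_zero : Fintype.card (Tens X 0) = 1 := rfl

omit [∀ k, Fintype (X k)] in
theorem single_tens_zero (i i' j j' : Tens X 0) : Matrix.single i i' (1 : ℂ) j j' = 1 := by
  rw [Matrix.single_apply, if_pos ⟨rfl, rfl⟩]

/-- The representation of the first `k` turns. -/
def Strategy.partialRep (s : Strategy n X Y) (k : ℕ) : Op (Tens Y k × Tens X k) :=
  choi (partialTrace (s.Z k) ∘ₗ s.run k)

theorem Strategy.choi_run_succ (s : Strategy n X Y) (k : ℕ) (j j' : Tens Y k) (y y' : Y k)
    (w w' : s.Z (k + 1)) (i i' : Tens X k × X k) :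
    choi (s.run (k + 1)) (((j, y), w), i) (((j', y'), w'), i') =
      choi (feed (s.run k) (s.Φ k)) ((j, (y, w)), i) ((j', (y', w')), i') :=
  choi_relabel (Equiv.prodAssoc (Tens Y k) (Y k) (s.Z (k + 1))).symm (feed (s.run k) (s.Φ k))
    ((j, y), w) ((j', y'), w') i i'

theorem Strategy.posSemidef_choi_run (s : Strategy n X Y) :
    ∀ k, k ≤ n → (choi (s.run k)).PosSemidef
  | 0, _ => posSemidef_choi_appendState PosSemidef.one
  | k + 1, hk => posSemidef_choi_relabel _ (posSemidef_choi_feed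
      (s.posSemidef_choi_run k (Nat.le_of_succ_le hk)) (s.admissible k hk).1.posSemidef_choi)

theorem Strategy.ptr_partialRep (s : Strategy n X Y) (k : ℕ) (hk : k < n) :
    ptr (splitOutput X Y k) (s.partialRep (k + 1)) = pad (splitInput X Y k) (s.partialRep k) := by
  ext ⟨j, i, l⟩ ⟨j', i', l'⟩
  rw [ptr_apply, pad_apply]
  change ∑ y, choi (partialTrace (s.Z (k + 1)) ∘ₗ s.run (k + 1)) ((j, y), (i, l)) ((j', y), (i', l'))
    = if l = l' then _ else 0
  refine Eq.trans ?_ (sum_choi_feed (s.run k) (s.admissible k hk) j j' i i' l l')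
  rw [Fintype.sum_prod_type]
  exact Finset.sum_congr rfl fun y _ => (choi_partialTrace (s.run (k + 1)) _ _ _ _).trans <|
    Finset.sum_congr rfl fun w _ => s.choi_run_succ k j j' y y w w (i, l) (i', l')

theorem Strategy.partialRep_mem (s : Strategy n X Y) :
    ∀ k, k ≤ n → s.partialRep k ∈ strategySpace X Y k
  | 0, _ => trivial
  | k + 1, hk => ⟨_, s.partialRep_mem k (Nat.le_of_succ_le hk), (s.ptr_partialRep k hk).symm⟩

theorem Strategy.trace_partialRep (s : Strategy n X Y) :
    ∀ k, k ≤ n → (s.partialRep k).trace = Fintype.card (Tens X k)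
  | 0, _ => by
    have h : ∀ i : Tens Y 0 × Tens X 0, s.partialRep 0 i i = 1 := fun ⟨j, i⟩ => by
      refine (choi_partialTrace (s.run 0) j j i i).trans ?_
      have : ∀ k, choi (s.run 0) ((j, k), i) ((j, k), i) = 1 := fun k => by
        refine (choi_appendState (a := Tens X 0) (1 : Op (s.Z 0)) j j k k i i).trans ?_
        refine (congrArg (· * (1 : Op (s.Z 0)) k k) (single_tens_zero (X := X) i i j j)).trans ?_
        rw [one_mul, Matrix.one_apply_eq]
      rw [Finset.sum_congr rfl fun k _ => this k]
      simp [s.card_Z_zero]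
    simp only [Matrix.trace, Matrix.diag, h]
    simp [card_tens_zero]
  | k + 1, hk => by
    rw [← trace_ptr (splitOutput X Y k), s.ptr_partialRep k hk, trace_pad,
      s.trace_partialRep k (Nat.le_of_succ_le hk), mul_comm, ← Nat.cast_mul, ← Fintype.card_prod]
    rfl

theorem Strategy.rep_mem (s : Strategy n X Y) :
    s.rep ∈ traceSlice (strategySpace X Y n) (Fintype.card (Tens X n)) := by
  refine ⟨s.partialRep_mem n le_rfl, ?_, ?_⟩
  · rw [Strategy.rep, ← effect_one]
    exact posSemidef_choi_effect (s.posSemidef_choi_run n le_rfl) PosSemidef.one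
  · rw [Complex.ofReal_natCast]
    exact s.trace_partialRep n le_rfl

theorem Measurement.posSemidef_one_sub {S : Type*} [Fintype S] {z : Type*} [Fintype z]
    [DecidableEq z] (M : Measurement S z) (a : S) : (1 - M.op a).PosSemidef := by
  classical
  rw [← M.sum_eq_one, ← Finset.sum_erase_eq_sub (Finset.mem_univ a)]
  exact posSemidef_sum _ fun s _ => M.posSemidef s

theorem choi_effect_one_sub {a b z : Type*} [Fintype a] [DecidableEq a] [Fintype b] [DecidableEq b]
    [Fintype z] [DecidableEq z] (P : Op z) (F : SuperOp a (b × z)) :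
    choi (effect (1 - P) ∘ₗ F) = choi (partialTrace z ∘ₗ F) - choi (effect P ∘ₗ F) := by
  ext ⟨j, i⟩ ⟨j', i'⟩
  rw [← effect_one, Matrix.sub_apply, choi_effect, choi_effect, choi_effect]
  simp [sub_mul]

theorem Strategy.posSemidef_measRep (s : Strategy n X Y) {S : Type v} [Fintype S]
    (M : Measurement S (s.Z n)) (a : S) : (s.measRep M a).PosSemidef :=
  posSemidef_choi_effect (s.posSemidef_choi_run n le_rfl) (M.posSemidef a)

/-- The difference belongs to the effect of all other outcomes. It makes `p = 1` feasible. -/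
theorem Strategy.posSemidef_rep_sub_measRep (s : Strategy n X Y) {S : Type v} [Fintype S]
    (M : Measurement S (s.Z n)) (a : S) : (s.rep - s.measRep M a).PosSemidef := by
  rw [Strategy.rep, Strategy.measRep, ← choi_effect_one_sub]
  exact posSemidef_choi_effect (s.posSemidef_choi_run n le_rfl) (M.posSemidef_one_sub a)

/-- The representation of the initial state and the first `k` maps of a co-strategy. -/
def CoStrategy.partialRep (c : CoStrategy m X Y) (k : ℕ) : Op (Tens Y k × Tens X (k + 1)) :=
  relabel (Equiv.prodComm _ _) (choi (partialTrace (c.W k) ∘ₗ c.run k)).transpose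

theorem CoStrategy.choi_run_succ (c : CoStrategy m X Y) (k : ℕ) (j j' : Tens X (k + 1))
    (y y' : X (k + 1)) (w w' : c.W (k + 1)) (i i' : Tens Y k × Y k) :
    choi (c.run (k + 1)) (((j, y), w), i) (((j', y'), w'), i') =
      choi (feed (c.run k) (c.Ψ k)) ((j, (y, w)), i) ((j', (y', w')), i') :=
  choi_relabel (Equiv.prodAssoc (Tens X (k + 1)) (X (k + 1)) (c.W (k + 1))).symm
    (feed (c.run k) (c.Ψ k)) ((j, y), w) ((j', y'), w') i i'

theorem CoStrategy.choi_run_zero (c : CoStrategy m X Y) (j j' : Tens X 0) (y y' : X 0)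
    (w w' : c.W 0) (i i' : Tens Y 0) :
    choi (c.run 0) (((j, y), w), i) (((j', y'), w'), i') = c.ρ (y, w) (y', w') := by
  refine (choi_relabel (Equiv.prodAssoc (Tens X 0) (X 0) (c.W 0)).symm
    (appendState (Tens Y 0) c.ρ) ((j, y), w) ((j', y'), w') i i').trans ?_
  refine (choi_appendState (a := Tens Y 0) c.ρ j j' (y, w) (y', w') i i').trans ?_
  exact (congrArg (· * c.ρ (y, w) (y', w')) (single_tens_zero (X := Y) i i' j j')).trans
    (one_mul _)

theorem CoStrategy.posSemidef_choi_run (c : CoStrategy m X Y) :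
    ∀ k, k ≤ m → (choi (c.run k)).PosSemidef
  | 0, _ => posSemidef_choi_relabel _ (posSemidef_choi_appendState c.isDensity.1)
  | k + 1, hk => posSemidef_choi_relabel _ (posSemidef_choi_feed
      (c.posSemidef_choi_run k (Nat.le_of_succ_le hk)) (c.admissible k hk).1.posSemidef_choi)

theorem CoStrategy.posSemidef_choi_runAll (c : CoStrategy m X Y) : (choi c.runAll).PosSemidef :=
  posSemidef_choi_feed (c.posSemidef_choi_run m le_rfl) c.admissible_last.1.posSemidef_choi

theorem CoStrategy.ptr_partialRep (c : CoStrategy m X Y) (k : ℕ) (hk : k < m) :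
    ptr (splitInput X Y (k + 1)) (c.partialRep (k + 1)) =
      pad (splitOutput X Y k) (c.partialRep k) := by
  ext ⟨⟨i, l⟩, j⟩ ⟨⟨i', l'⟩, j'⟩
  rw [ptr_apply, pad_apply]
  change ∑ y, choi (partialTrace (c.W (k + 1)) ∘ₗ c.run (k + 1)) ((j', y), (i', l')) ((j, y), (i, l))
    = if l = l' then choi (partialTrace (c.W k) ∘ₗ c.run k) (j', i') (j, i) else 0
  simp only [eq_comm (a := l)]
  refine Eq.trans ?_ (sum_choi_feed (c.run k) (c.admissible k hk) j' j i' i l' l)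
  rw [Fintype.sum_prod_type]
  exact Finset.sum_congr rfl fun y _ => (choi_partialTrace (c.run (k + 1)) _ _ _ _).trans <|
    Finset.sum_congr rfl fun w _ => c.choi_run_succ k j' j y y w w (i', l') (i, l)

/-- The last map sends no message, so the last `Y` is only absorbed and appears as an identity
factor. -/
theorem CoStrategy.rep_eq_pad (c : CoStrategy m X Y) :
    c.rep = pad (splitOutput X Y m) (c.partialRep m) := by
  ext ⟨⟨i, l⟩, j⟩ ⟨⟨i', l'⟩, j'⟩
  rw [pad_apply]
  change choi (partialTrace c.Wlast ∘ₗ c.runAll) (j', (i', l')) (j, (i, l))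
    = if l = l' then choi (partialTrace (c.W m) ∘ₗ c.run m) (j', i') (j, i) else 0
  simp only [eq_comm (a := l)]
  refine Eq.trans ?_ (sum_choi_feed (c.run m) c.admissible_last j' j i' i l' l)
  exact choi_partialTrace c.runAll j' j (i', l') (i, l)

/-- A co-strategy speaks first, so its partial representations have one more `X` than `Y` and lie
halfway between two levels of `coStrategySpace`; tracing out that `X` reaches a level. -/
theorem CoStrategy.ptr_partialRep_mem (c : CoStrategy m X Y) :
    ∀ k, k ≤ m → ptr (splitInput X Y k) (c.partialRep k) ∈ coStrategySpace X Y k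
  | 0, _ => trivial
  | k + 1, hk => ⟨_, c.ptr_partialRep_mem k (Nat.le_of_succ_le hk), (c.ptr_partialRep k hk).symm⟩

theorem CoStrategy.trace_partialRep (c : CoStrategy m X Y) :
    ∀ k, k ≤ m → (c.partialRep k).trace = Fintype.card (Tens Y k)
  | 0, _ => by
    have h : ∀ (i : Tens Y 0) (j : Tens X 0) (y : X 0), c.partialRep 0 (i, (j, y)) (i, (j, y)) =
        ∑ w, c.ρ (y, w) (y, w) := fun i j y =>
      (choi_partialTrace (c.run 0) (j, y) (j, y) i i).trans
        (Finset.sum_congr rfl fun w _ => c.choi_run_zero j j y y w w i i)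
    have h1 : (c.partialRep 0).trace = ∑ i : Tens Y 0, ∑ j : Tens X 0, ∑ y,
        c.partialRep 0 (i, (j, y)) (i, (j, y)) := by
      refine (Fintype.sum_prod_type _).trans (Finset.sum_congr rfl fun i _ => ?_)
      exact Fintype.sum_prod_type _
    have h2 := c.isDensity.2
    rw [Matrix.trace, Fintype.sum_prod_type] at h2
    rw [h1]
    simp only [h]
    simp only [Matrix.diag] at h2
    rw [h2]
    simp [card_tens_zero]
  | k + 1, hk => by
    rw [← trace_ptr (splitInput X Y (k + 1)), c.ptr_partialRep k hk, trace_pad,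
      c.trace_partialRep k (Nat.le_of_succ_le hk), mul_comm, ← Nat.cast_mul, ← Fintype.card_prod]
    rfl

theorem posSemidef_relabel {a b : Type*} [Fintype a] [Fintype b] (e : a ≃ b) {A : Op a}
    (hA : A.PosSemidef) : (relabel e A).PosSemidef :=
  hA.submatrix e.symm

theorem CoStrategy.rep_mem (c : CoStrategy m X Y) :
    c.rep ∈ traceSlice (coStrategySpace X Y (m + 1)) (Fintype.card (Tens Y (m + 1))) := by
  refine ⟨⟨_, c.ptr_partialRep_mem m le_rfl, c.rep_eq_pad.symm⟩, ?_, ?_⟩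
  · rw [CoStrategy.rep, ← effect_one]
    exact posSemidef_relabel _
      (posSemidef_choi_effect c.posSemidef_choi_runAll PosSemidef.one).transpose
  · rw [Complex.ofReal_natCast, c.rep_eq_pad, trace_pad, c.trace_partialRep m le_rfl, mul_comm,
      ← Nat.cast_mul, ← Fintype.card_prod]
    rfl

theorem CoStrategy.posSemidef_measRep (c : CoStrategy m X Y) {S : Type v} [Fintype S]
    (M : Measurement S c.Wlast) (b : S) : (c.measRep M b).PosSemidef :=
  posSemidef_relabel _ (posSemidef_choi_effect c.posSemidef_choi_runAll (M.posSemidef b)).transpose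

theorem CoStrategy.posSemidef_rep_sub_measRep (c : CoStrategy m X Y) {S : Type v} [Fintype S]
    (M : Measurement S c.Wlast) (b : S) : (c.rep - c.measRep M b).PosSemidef := by
  rw [CoStrategy.rep, CoStrategy.measRep, ← map_sub, ← transpose_sub, ← choi_effect_one_sub]
  exact posSemidef_relabel _
    (posSemidef_choi_effect c.posSemidef_choi_runAll (M.posSemidef_one_sub b)).transpose

end Forward

/-! ### Realizing operators by strategies -/

section Purification

open Matrix

variable {r : Type*} [Fintype r] [DecidableEq r]

theorem Matrix.IsHermitian.exists_pseudoinverse {S : Op r} (hS : S.IsHermitian) :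
    ∃ G P : Op r, G.IsHermitian ∧ P.IsHermitian ∧ S * G = P ∧ G * S = P ∧ P * S = S := by
  set U : Op r := hS.eigenvectorUnitary.1 with hU
  have hUU : star U * U = 1 := Unitary.coe_star_mul_self hS.eigenvectorUnitary
  let φ : (r → ℂ) → Op r := fun f => U * diagonal f * star U
  have hφ : ∀ f g, φ f * φ g = φ (f * g) := by
    intro f g
    calc φ f * φ g = U * diagonal f * (star U * U) * diagonal g * star U := by
          simp only [φ, Matrix.mul_assoc]
      _ = φ (f * g) := by
          rw [hUU, Matrix.mul_one, Matrix.mul_assoc U, diagonal_mul_diagonal]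
          rfl
  have hφh : ∀ f : r → ℝ, (φ fun i => (f i : ℂ)).IsHermitian := by
    intro f
    have hd : (diagonal fun i => (f i : ℂ))ᴴ = diagonal fun i => (f i : ℂ) := by
      rw [diagonal_conjTranspose]
      congr 1
      ext i
      simp
    simp only [φ, Matrix.IsHermitian, star_eq_conjTranspose, conjTranspose_mul, hd,
      conjTranspose_conjTranspose, Matrix.mul_assoc]
  obtain ⟨μ, hSφ⟩ : ∃ μ : r → ℝ, S = φ fun i => (μ i : ℂ) := ⟨hS.eigenvalues, hS.spectral_theorem⟩
  -- With `0⁻¹ = 0`, inverting the eigenvalues gives the Moore–Penrose inverse, and `μ * μ⁻¹` gives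
  -- the projection onto the range.
  refine ⟨φ fun i => (((μ i)⁻¹ : ℝ) : ℂ), φ fun i => ((μ i * (μ i)⁻¹ : ℝ) : ℂ), hφh _, hφh _,
    ?_, ?_, ?_⟩
  · rw [hSφ, hφ]
    congr 1
    ext i
    simp
  · rw [hSφ, hφ]
    congr 1
    ext i
    simp [mul_comm]
  · rw [hSφ, hφ]
    congr 1
    ext i
    simp

theorem Matrix.PosSemidef.exists_sqrt {R : Op r} (hR : R.PosSemidef) :
    ∃ S : Op r, S.IsHermitian ∧ S * S = R := by
  open scoped MatrixOrder in
  obtain ⟨S, hS, h⟩ := CStarAlgebra.nonneg_iff_exists_isSelfAdjoint_and_eq_mul_self.1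
    (nonneg_iff_posSemidef.2 hR)
  exact ⟨S, hS, h.symm⟩

/-- A partial isometry extends to an admissible map. -/
theorem exists_admissible_of_partialIsometry {i o : Type*} [Fintype i] [DecidableEq i] [Fintype o]
    [DecidableEq o] [Nonempty o] (L : Matrix i o ℂ) {P : Op i} (hP : P.IsHermitian)
    (hPP : P * P = P) (hL : L * Lᴴ = P) :
    ∃ (Φ : SuperOp i o) (k₀ : o), Φ.Admissible ∧ ∀ k k' l l', choi Φ (k, l) (k', l') =
      L l k * star (L l' k') + if k = k₀ ∧ k' = k₀ then (1 - P) l l' else 0 := by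
  obtain ⟨k₀⟩ := ‹Nonempty o›
  have hQ : (1 - P) * (1 - P) = 1 - P := by
    simp [mul_sub, sub_mul, hPP]
  have hQ' : ∀ l l', ∑ s, (1 - P) l s * (1 - P) s l' = (1 - P) l l' := fun l l' => by
    rw [← Matrix.mul_apply, hQ]
  have hQs : ∀ l l', star ((1 - P) l l') = (1 - P) l' l := fun l l' => by
    rw [← conjTranspose_apply, conjTranspose_sub, conjTranspose_one, hP.eq]
  -- One Kraus operator is the partial isometry; the others send the complement of its support to
  -- the basis vector `k₀`, which restores trace preservation.
  set K : Option i → Matrix o i ℂ := fun s =>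
    s.elim Lᵀ (fun s => Matrix.of fun k l => if k = k₀ then (1 - P) l s else 0) with hK
  refine ⟨krausMap K, k₀, admissible_krausMap K ?_, ?_⟩
  · rw [Fintype.sum_option]
    have h1 : (K none)ᴴ * K none = Pᵀ := by
      change Lᵀᴴ * Lᵀ = Pᵀ
      rw [← hL, transpose_mul]
      rfl
    have h2 : ∑ s, (K (some s))ᴴ * K (some s) = (1 - P)ᵀ := by
      ext l l'
      rw [Matrix.sum_apply]
      refine Eq.trans (Finset.sum_congr rfl fun s _ => ?_) (hQ' l' l)
      simp only [Matrix.mul_apply, conjTranspose_apply, hK, Option.elim_some, Matrix.of_apply]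
      rw [Finset.sum_eq_single k₀]
      · simp only [if_true, hQs, mul_comm]
      · intro k _ hk
        simp [hk]
      · simp
    rw [h1, h2, ← transpose_add]
    simp
  · intro k k' l l'
    rw [choi_krausMap, Fintype.sum_option]
    congr 1
    simp only [hK, Option.elim_some, Matrix.of_apply]
    by_cases h : k = k₀
    · by_cases h' : k' = k₀
      · simp only [h, h', if_true, and_self, hQs, hQ']
      · simp [h']
    · simp [h]

/-- The super-operator `F` is conjugation by the operator whose vectorization is `S`. -/
def IsPurification {a b z : Type*} [Fintype a] [DecidableEq a] (F : SuperOp a (b × z))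
    (S : Matrix (b × a) z ℂ) : Prop :=
  ∀ j j' k k' i i', choi F ((j, k), i) ((j', k'), i') = S (j, i) k * star (S (j', i') k')

theorem IsPurification.choi_partialTrace {a b z : Type*} [Fintype a] [DecidableEq a] [Fintype z]
    {F : SuperOp a (b × z)} {S : Matrix (b × a) z ℂ} (h : IsPurification F S) :
    choi (partialTrace z ∘ₗ F) = S * Sᴴ := by
  ext ⟨j, i⟩ ⟨j', i'⟩
  rw [_root_.choi_partialTrace, Matrix.mul_apply]
  exact Finset.sum_congr rfl fun k _ => h _ _ _ _ _ _

/-- By hypothesis, `S'` with its rows and columns regrouped as `N` satisfies `N Nᴴ = 1 ⊗ S²`, so `N`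
and `1 ⊗ S` purify the same operator. The partial isometry `L = (1 ⊗ G) N` satisfies `(1 ⊗ S) L =
N`, and extending it to an admissible map is harmless because the extension acts only where `S`
vanishes. -/
theorem exists_admissible_purification {a b x y : Type*} [Fintype a] [DecidableEq a] [Fintype b]
    [DecidableEq b] [Fintype x] [DecidableEq x] [Fintype y] [DecidableEq y] [Nonempty a]
    [Nonempty b] [Nonempty x] [Nonempty y] {S : Op (a × b)} (hS : S.IsHermitian)
    (S' : Op ((a × y) × (b × x)))
    (h : ∀ j j' i i' l l', ∑ k, (S' * S'ᴴ) ((j, k), (i, l)) ((j', k), (i', l')) =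
      if l = l' then (S * S) (j, i) (j', i') else 0) :
    ∃ Φ : SuperOp (x × (a × b)) (y × ((a × y) × (b × x))), Φ.Admissible ∧
      ∀ F : SuperOp b (a × (a × b)), IsPurification F S →
        IsPurification (relabel (Equiv.prodAssoc a y ((a × y) × (b × x))).symm ∘ₗ feed F Φ) S' := by
  obtain ⟨G, P, hG, hP, hSG, hGS, hPS⟩ := hS.exists_pseudoinverse
  have hPP : P * P = P := by
    nth_rewrite 2 [← hSG]
    rw [← Matrix.mul_assoc, hPS, hSG]
  have hSP : S * P = S := by
    have := congrArg conjTranspose hPS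
    rwa [conjTranspose_mul, hS.eq, hP.eq] at this
  set N : Matrix (x × (a × b)) (y × ((a × y) × (b × x))) ℂ :=
    Matrix.of fun l k => S' ((l.2.1, k.1), (l.2.2, l.1)) k.2 with hN
  have hNN : N * Nᴴ = (1 : Op x) ⊗ₖ (S * S) := by
    ext ⟨l, j, i⟩ ⟨l', j', i'⟩
    rw [Matrix.mul_apply, Fintype.sum_prod_type, kroneckerMap_apply, Matrix.one_apply, ite_mul,
      one_mul, zero_mul, ← h]
    rfl
  have hkP : ((1 : Op x) ⊗ₖ P).IsHermitian := by
    rw [Matrix.IsHermitian, conjTranspose_kronecker, hP.eq, conjTranspose_one]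
  have hkG : ((1 : Op x) ⊗ₖ G).IsHermitian := by
    rw [Matrix.IsHermitian, conjTranspose_kronecker, hG.eq, conjTranspose_one]
  -- `N` and `N Nᴴ` have the same range, and that of `N Nᴴ = 1 ⊗ S²` lies in the range of `1 ⊗ P`.
  have hPN : ((1 : Op x) ⊗ₖ P) * N = N := by
    have h0 : (((1 : Op x) ⊗ₖ P) * N - N) * (((1 : Op x) ⊗ₖ P) * N - N)ᴴ = 0 := by
      have e1 : ((1 : Op x) ⊗ₖ P) * ((1 : Op x) ⊗ₖ (S * S)) = (1 : Op x) ⊗ₖ (S * S) := by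
        rw [← mul_kronecker_mul, ← Matrix.mul_assoc, hPS, Matrix.one_mul]
      have e2 : (((1 : Op x) ⊗ₖ P) * N - N) * Nᴴ = 0 := by
        rw [Matrix.sub_mul, Matrix.mul_assoc, hNN, e1, sub_self]
      rw [conjTranspose_sub, conjTranspose_mul, hkP.eq, Matrix.mul_sub, ← Matrix.mul_assoc, e2,
        Matrix.zero_mul, sub_self]
    exact sub_eq_zero.1 (self_mul_conjTranspose_eq_zero.1 h0)
  obtain ⟨Φ, k₀, hΦ, hc⟩ := exists_admissible_of_partialIsometry (((1 : Op x) ⊗ₖ G) * N) hkP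
    (by rw [← mul_kronecker_mul, hPP, Matrix.one_mul]) (by
      rw [conjTranspose_mul, hkG.eq, ← Matrix.mul_assoc, Matrix.mul_assoc _ N, hNN,
        ← mul_kronecker_mul, ← mul_kronecker_mul, ← Matrix.mul_assoc, hGS, hPS, hSG, Matrix.one_mul,
        Matrix.one_mul])
  refine ⟨Φ, hΦ, fun F hF => ?_⟩
  rintro ⟨j, y₁⟩ ⟨j', y₁'⟩ k k' ⟨i, l⟩ ⟨i', l'⟩
  rw [choi_relabel]
  change choi (feed F Φ) ((j, (y₁, k)), (i, l)) ((j', (y₁', k')), (i', l')) = _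
  rw [choi_feed]
  simp only [hF j j', hc, mul_add, Finset.sum_add_distrib]
  have h1 : ∀ j i l k, ∑ s, S (j, i) s * (((1 : Op x) ⊗ₖ G) * N) (l, s) k = N (l, (j, i)) k := by
    intro j i l k
    have e2 : (((1 : Op x) ⊗ₖ S) * (((1 : Op x) ⊗ₖ G) * N)) (l, (j, i)) k = N (l, (j, i)) k := by
      rw [← Matrix.mul_assoc, ← mul_kronecker_mul, hSG, Matrix.one_mul, hPN]
    rw [← e2, Matrix.mul_apply (M := (1 : Op x) ⊗ₖ S), Fintype.sum_prod_type (α₁ := x),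
      Finset.sum_eq_single l]
    · simp
    · intro l₁ _ hl
      simp [Matrix.one_apply_ne hl.symm]
    · simp
  -- The contribution of the extension is killed by `S (1 - P) = 0`.
  have h2 : ∑ s, ∑ s', S (j, i) s * star (S (j', i') s') *
      (1 - (1 : Op x) ⊗ₖ P) (l, s) (l', s') = 0 := by
    have e3 : ∀ s s', (1 - (1 : Op x) ⊗ₖ P) (l, s) (l', s') =
        (1 : Op x) l l' * (1 - P) s s' := by
      intro s s'
      rw [Matrix.sub_apply, Matrix.sub_apply, kroneckerMap_apply, ← one_kronecker_one,
        kroneckerMap_apply]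
      ring
    have e4 : (S * (1 - P) * Sᴴ) (j, i) (j', i') = 0 := by
      rw [mul_sub, hSP]
      simp
    rw [Matrix.mul_apply] at e4
    simp only [Matrix.mul_apply (M := S), conjTranspose_apply, Finset.sum_mul] at e4
    simp only [e3]
    calc _ = (1 : Op x) l l' * ∑ s', ∑ s, S (j, i) s * (1 - P) s s' * star (S (j', i') s') := by
          rw [Finset.sum_comm, Finset.mul_sum]
          refine Finset.sum_congr rfl fun s' _ => ?_
          rw [Finset.mul_sum]
          exact Finset.sum_congr rfl fun s _ => by ring
      _ = 0 := by rw [e4, mul_zero]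
  have h3 : ∑ s, ∑ s', S (j, i) s * star (S (j', i') s') *
      (((((1 : Op x) ⊗ₖ G) * N) (l, s) (y₁, k)) * star ((((1 : Op x) ⊗ₖ G) * N) (l', s') (y₁', k')))
      = N (l, (j, i)) (y₁, k) * star (N (l', (j', i')) (y₁', k')) := by
    rw [← h1 j i, ← h1 j' i', star_sum, Finset.sum_mul_sum]
    refine Finset.sum_congr rfl fun s _ => Finset.sum_congr rfl fun s' _ => ?_
    rw [star_mul']
    ring
  rw [h3]
  split_ifs
  · rw [h2, add_zero]
    rfl
  · simp only [mul_zero, Finset.sum_const_zero, add_zero]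
    rfl

end Purification

/-! ### Every element of a normalized slice is a representation -/

section Realization

open Matrix

set_option linter.unusedSectionVars false

theorem posSemidef_ptr {I c y : Type*} [Fintype I] [Fintype c] [Fintype y] (e : I ≃ c × y)
    {A : Op I} (hA : A.PosSemidef) : (ptr e A).PosSemidef := by
  have : ptr e A = ∑ k, A.submatrix (fun i => e.symm (i, k)) (fun i => e.symm (i, k)) := by
    ext i j
    rw [ptr_apply, Matrix.sum_apply]
    rfl
  rw [this]
  exact posSemidef_sum _ fun k _ => hA.submatrix _

theorem posSemidef_of_pad {I c y : Type*} [Fintype I] [Fintype c] [Fintype y] [DecidableEq y]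
    [Nonempty y] (e : I ≃ c × y) {A : Op c} (hA : (pad e A).PosSemidef) : A.PosSemidef := by
  obtain ⟨k⟩ := ‹Nonempty y›
  have : A = (pad e A).submatrix (fun i => e.symm (i, k)) (fun i => e.symm (i, k)) := by
    ext i j
    simp [pad_apply]
  rw [this]
  exact hA.submatrix _

theorem exists_admissible_punit (i : Type*) [Fintype i] [DecidableEq i] :
    ∃ Φ : SuperOp i PUnit.{u + 1}, Φ.Admissible := by
  refine ⟨krausMap fun s : i => Matrix.of fun _ l => if l = s then 1 else 0,
    admissible_krausMap _ ?_⟩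
  ext l l'
  simp [Matrix.sum_apply, Matrix.mul_apply, Matrix.one_apply]

theorem trace_mul_conjTranspose_of_subsingleton {r : Type*} [Fintype r] [Subsingleton r] (S : Op r)
    (p q p' q' : r) : (S * Sᴴ).trace = S p q * star (S p' q') := by
  obtain rfl := Subsingleton.elim p q
  obtain rfl := Subsingleton.elim p p'
  obtain rfl := Subsingleton.elim p q'
  simp [Matrix.trace, Matrix.mul_apply, Fintype.sum_subsingleton _ p]

variable {X Y : ℕ → Type u}
variable [∀ k, Fintype (X k)] [∀ k, DecidableEq (X k)] [∀ k, Nonempty (X k)]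
variable [∀ k, Fintype (Y k)] [∀ k, DecidableEq (Y k)] [∀ k, Nonempty (Y k)]

theorem card_tens_succ (k : ℕ) :
    Fintype.card (Tens X (k + 1)) = Fintype.card (Tens X k) * Fintype.card (X k) :=
  Fintype.card_prod (Tens X k) (X k)

/-- Each level of `strategySpace` provides the operator of one turn less. Padding reflects
positivity and multiplies the trace by a known dimension, so both normalizations descend. Values
beyond `n` are irrelevant. -/
theorem exists_strategy_chain : ∀ (n : ℕ) (R : Op (Tens Y n × Tens X n)),
    R ∈ traceSlice (strategySpace X Y n) (Fintype.card (Tens X n)) →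
    ∃ C : ∀ k, Op (Tens Y k × Tens X k), (C 0).trace = 1 ∧ C n = R ∧
      (∀ k, k ≤ n → (C k).PosSemidef) ∧
      ∀ k, k < n → ptr (splitOutput X Y k) (C (k + 1)) = pad (splitInput X Y k) (C k)
  | 0, R, hR => by
    refine ⟨Function.update (fun _ => 0) 0 R, ?_, ?_, ?_, ?_⟩
    · rw [Function.update_self, hR.2.2, card_tens_zero]
      simp
    · rw [Function.update_self]
    · intro k hk
      obtain rfl := Nat.le_zero.1 hk
      rw [Function.update_self]
      exact hR.2.1
    · intro k hk
      exact absurd hk (Nat.not_lt_zero k)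
  | n + 1, R, hR => by
    obtain ⟨R', hR', h⟩ := hR.1
    have hx : (Fintype.card (X n) : ℂ) ≠ 0 := by exact_mod_cast Fintype.card_ne_zero
    obtain ⟨C, hC0, hCn, hCp, hC⟩ := exists_strategy_chain n R' ⟨hR', by
      refine posSemidef_of_pad (splitInput X Y n) ?_
      rw [h]
      exact posSemidef_ptr _ hR.2.1, by
      have h1 := congrArg Matrix.trace h
      rw [trace_pad, trace_ptr, hR.2.2, card_tens_succ] at h1
      push_cast at h1 ⊢
      exact mul_left_cancel₀ hx (h1.trans (mul_comm _ _))⟩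
    refine ⟨Function.update C (n + 1) R, ?_, ?_, ?_, ?_⟩
    · rw [Function.update_of_ne (Nat.succ_ne_zero n).symm, hC0]
    · rw [Function.update_self]
    · intro k hk
      rcases hk.eq_or_lt with rfl | hk
      · rw [Function.update_self]
        exact hR.2.1
      · rw [Function.update_of_ne hk.ne]
        exact hCp k (Nat.lt_succ_iff.1 hk)
    · intro k hk
      rw [Function.update_of_ne hk.ne]
      rcases (Nat.lt_succ_iff.1 hk).eq_or_lt with rfl | hk'
      · rw [Function.update_self, hCn, h]
      · rw [Function.update_of_ne (by omega)]
        exact hC k hk'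

theorem exists_coStrategy_chain : ∀ (m : ℕ) (T : Op (Tens Y m × Tens X (m + 1))),
    ptr (splitInput X Y m) T ∈ coStrategySpace X Y m → T.PosSemidef →
    T.trace = Fintype.card (Tens Y m) →
    ∃ C : ∀ k, Op (Tens Y k × Tens X (k + 1)), (C 0).trace = 1 ∧ C m = T ∧
      (∀ k, k ≤ m → (C k).PosSemidef) ∧
      ∀ k, k < m → ptr (splitInput X Y (k + 1)) (C (k + 1)) = pad (splitOutput X Y k) (C k)
  | 0, T, _, hTp, hTt => by
    refine ⟨Function.update (fun _ => 0) 0 T, ?_, ?_, ?_, ?_⟩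
    · rw [Function.update_self, hTt, card_tens_zero]
      simp
    · rw [Function.update_self]
    · intro k hk
      obtain rfl := Nat.le_zero.1 hk
      rw [Function.update_self]
      exact hTp
    · intro k hk
      exact absurd hk (Nat.not_lt_zero k)
  | m + 1, T, hT, hTp, hTt => by
    obtain ⟨T', hT', h⟩ := hT
    have hy : (Fintype.card (Y m) : ℂ) ≠ 0 := by exact_mod_cast Fintype.card_ne_zero
    obtain ⟨C, hC0, hCn, hCp, hC⟩ := exists_coStrategy_chain m T' hT' (by
      refine posSemidef_of_pad (splitOutput X Y m) ?_
      rw [h]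
      exact posSemidef_ptr _ hTp) (by
      have h1 := congrArg Matrix.trace h
      rw [trace_pad, trace_ptr, hTt, card_tens_succ] at h1
      push_cast at h1 ⊢
      exact mul_left_cancel₀ hy (h1.trans (mul_comm _ _)))
    refine ⟨Function.update C (m + 1) T, ?_, ?_, ?_, ?_⟩
    · rw [Function.update_of_ne (Nat.succ_ne_zero m).symm, hC0]
    · rw [Function.update_self]
    · intro k hk
      rcases hk.eq_or_lt with rfl | hk
      · rw [Function.update_self]
        exact hTp
      · rw [Function.update_of_ne hk.ne]
        exact hCp k (Nat.lt_succ_iff.1 hk)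
    · intro k hk
      rw [Function.update_of_ne hk.ne]
      rcases (Nat.lt_succ_iff.1 hk).eq_or_lt with rfl | hk'
      · rw [Function.update_self, hCn, h]
      · rw [Function.update_of_ne (by omega)]
        exact hC k hk'

theorem exists_sqrt_family {ι : Type*} {r : ι → Type*} [∀ k, Fintype (r k)] [∀ k, DecidableEq (r k)]
    (C : ∀ k, Op (r k)) : ∃ S : ∀ k, Op (r k), ∀ k, (S k).IsHermitian ∧
      ((C k).PosSemidef → S k * S k = C k) := by
  have : ∀ k, ∃ S : Op (r k), S.IsHermitian ∧ ((C k).PosSemidef → S * S = C k) := fun k => by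
    by_cases h : (C k).PosSemidef
    · obtain ⟨S, hS, hSC⟩ := h.exists_sqrt
      exact ⟨S, hS, fun _ => hSC⟩
    · exact ⟨0, isHermitian_zero, fun h' => absurd h' h⟩
  choose S hS using this
  exact ⟨S, hS⟩

/-- The memory after `k` turns is a copy of `Tens Y k × Tens X k`, on which the square root of `C k`
purifies it; each turn carries one purification to the next. -/
theorem traceSlice_subset_strategyReps (n : ℕ) :
    traceSlice (strategySpace X Y n) (Fintype.card (Tens X n)) ⊆ strategyReps n X Y := by
  intro R hR
  obtain ⟨C, hC0, hCn, hCp, hC⟩ := exists_strategy_chain n R hR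
  obtain ⟨S, hS⟩ := exists_sqrt_family C
  have hstep : ∀ k, ∃ Φ : SuperOp (X k × (Tens Y k × Tens X k))
      (Y k × (Tens Y (k + 1) × Tens X (k + 1))), k < n → Φ.Admissible ∧
      ∀ F : SuperOp (Tens X k) (Tens Y k × (Tens Y k × Tens X k)), IsPurification F (S k) →
        IsPurification (relabel (Equiv.prodAssoc (Tens Y k) (Y k)
          (Tens Y (k + 1) × Tens X (k + 1))).symm ∘ₗ feed F Φ) (S (k + 1)) := by
    intro k
    by_cases hk : k < n
    · obtain ⟨Φ, h1, h2⟩ := exists_admissible_purification (a := Tens Y k) (b := Tens X k)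
        (x := X k) (y := Y k) (hS k).1 (S (k + 1)) (by
          intro j j' i i' l l'
          have h3 := congrFun (congrFun (hC k hk) (j, (i, l))) (j', (i', l'))
          rw [ptr_apply, pad_apply] at h3
          refine Eq.trans ?_ (h3.trans ?_)
          · refine Finset.sum_congr rfl fun y _ => ?_
            have h4 : S (k + 1) * (S (k + 1))ᴴ = C (k + 1) := by
              rw [(hS (k + 1)).1.eq, (hS (k + 1)).2 (hCp _ hk)]
            exact congrFun (congrFun h4 _) _
          · rw [(hS k).2 (hCp k hk.le)]
            rfl)
      exact ⟨Φ, fun _ => ⟨h1, h2⟩⟩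
    · exact ⟨0, fun h => absurd h hk⟩
  choose Φ hΦ using hstep
  let s : Strategy n X Y :=
    { Z := fun k => Tens Y k × Tens X k
      card_Z_zero := rfl
      Φ := Φ
      admissible := fun k hk => (hΦ k hk).1 }
  have hrun : ∀ k, k ≤ n → IsPurification (s.run k) (S k) := by
    intro k
    induction k with
    -- All spaces are one-dimensional here and `C 0` has trace `1`, so `S 0` is a scalar of modulus
    -- `1` and the trivial start purifies it.
    | zero =>
      intro _ j j' w w' i i'
      refine (choi_appendState (a := Tens X 0) (1 : Op (s.Z 0)) j j' w w' i i').trans ?_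
      refine (congrArg (· * (1 : Op (s.Z 0)) w w')
        (single_tens_zero (X := X) i i' j j')).trans ?_
      have e : C 0 = S 0 * (S 0)ᴴ := by rw [(hS 0).1.eq, (hS 0).2 (hCp 0 (Nat.zero_le n))]
      have h0 := hC0
      rw [e] at h0
      have hsub : Subsingleton (Tens Y 0 × Tens X 0) :=
        inferInstanceAs (Subsingleton (PUnit × PUnit))
      rw [← trace_mul_conjTranspose_of_subsingleton, h0, one_mul,
        show w = w' from hsub.elim w w', Matrix.one_apply_eq]
    | succ k ih =>
      intro hk
      exact (hΦ k hk).2 _ (ih (Nat.le_of_succ_le hk))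
  refine ⟨s, ?_⟩
  have h := (hrun n le_rfl).choi_partialTrace
  rw [(hS n).1.eq, (hS n).2 (hCp n le_rfl), hCn] at h
  exact h

/-- The same purification with the roles of `X` and `Y` exchanged. Roots are taken of the transposed
operators because representations of co-strategies are transposed. -/
theorem traceSlice_subset_coStrategyReps (m : ℕ) :
    traceSlice (coStrategySpace X Y (m + 1)) (Fintype.card (Tens Y (m + 1))) ⊆
      coStrategyReps m X Y := by
  rintro T ⟨⟨T', hT', rfl⟩, hTp, hTt⟩
  have hy : (Fintype.card (Y m) : ℂ) ≠ 0 := by exact_mod_cast Fintype.card_ne_zero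
  obtain ⟨C, hC0, hCn, hCp, hC⟩ := exists_coStrategy_chain m T' hT'
    (posSemidef_of_pad (splitOutput X Y m) hTp) (by
      rw [trace_pad, card_tens_succ] at hTt
      push_cast at hTt ⊢
      exact mul_left_cancel₀ hy (hTt.trans (mul_comm _ _)))
  obtain ⟨S, hS⟩ := exists_sqrt_family (r := fun k => Tens X (k + 1) × Tens Y k)
    fun k => relabel (Equiv.prodComm _ _) (C k).transpose
  have hSC : ∀ k, k ≤ m → S k * (S k)ᴴ = relabel (Equiv.prodComm _ _) (C k).transpose :=
    fun k hk => by
      rw [(hS k).1.eq, (hS k).2 (posSemidef_relabel _ (hCp k hk).transpose)]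
  have hstep : ∀ k, ∃ Ψ : SuperOp (Y k × (Tens X (k + 1) × Tens Y k))
      (X (k + 1) × (Tens X (k + 2) × Tens Y (k + 1))), k < m → Ψ.Admissible ∧
      ∀ F : SuperOp (Tens Y k) (Tens X (k + 1) × (Tens X (k + 1) × Tens Y k)),
        IsPurification F (S k) →
        IsPurification (relabel (Equiv.prodAssoc (Tens X (k + 1)) (X (k + 1))
          (Tens X (k + 2) × Tens Y (k + 1))).symm ∘ₗ feed F Ψ) (S (k + 1)) := by
    intro k
    by_cases hk : k < m
    · obtain ⟨Ψ, h1, h2⟩ := exists_admissible_purification (a := Tens X (k + 1)) (b := Tens Y k)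
        (x := Y k) (y := X (k + 1)) (hS k).1 (S (k + 1)) (by
          intro j j' i i' l l'
          have h3 := congrFun (congrFun (hC k hk) ((i', l'), j')) ((i, l), j)
          rw [ptr_apply, pad_apply] at h3
          refine Eq.trans ?_ (h3.trans ?_)
          · refine Finset.sum_congr rfl fun y _ => ?_
            exact congrFun (congrFun (hSC (k + 1) hk) _) _
          · have h4 := hSC k hk.le
            rw [(hS k).1.eq] at h4
            rw [h4]
            exact if_congr eq_comm rfl rfl)
      exact ⟨Ψ, fun _ => ⟨h1, h2⟩⟩
    · exact ⟨0, fun h => absurd h hk⟩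
  choose Ψ hΨ using hstep
  -- The last memory is traced out in the representation, so the last map may discard everything.
  obtain ⟨Ψlast, hlast⟩ := exists_admissible_punit.{u} (Y m × (Tens X (m + 1) × Tens Y m))
  have hpt : Nonempty (Tens X 0) := inferInstance
  obtain ⟨t⟩ := hpt
  have hpt' : Nonempty (Tens Y 0) := inferInstance
  obtain ⟨t'⟩ := hpt'
  have htrace : (S 0 * (S 0)ᴴ).trace = 1 := by
    rw [hSC 0 (Nat.zero_le m), ← hC0]
    exact (Equiv.prodComm _ _).sum_comp fun i => C 0 i i
  let e : X 0 ≃ Tens X 1 × Tens Y 0 :=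
    ⟨fun y => ((t, y), t'), fun p => p.1.2, fun _ => rfl, fun _ => rfl⟩
  let c : CoStrategy m X Y :=
    { W := fun k => Tens X (k + 1) × Tens Y k
      Wlast := PUnit
      -- The initial state is the pure state whose vector is `S 0` unrolled, with `W 0` as purifying
      -- system; its norm is `1` because `C 0` has trace `1`.
      ρ := vecMulVec (fun p => S 0 ((t, p.1), t') p.2) (star fun p => S 0 ((t, p.1), t') p.2)
      isDensity := by
        refine ⟨posSemidef_vecMulVec_self_star _, ?_⟩
        rw [← htrace]
        exact (Fintype.sum_prod_type _).trans (e.sum_comp fun p => (S 0 * (S 0)ᴴ) p p)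
      Ψ := Ψ
      admissible := fun k hk => (hΨ k hk).1
      Ψlast := Ψlast
      admissible_last := hlast }
  have hrun : ∀ k, k ≤ m → IsPurification (c.run k) (S k) := by
    intro k
    induction k with
    | zero =>
      rintro _ ⟨j, y⟩ ⟨j', y'⟩ w w' i i'
      exact c.choi_run_zero j j' y y' w w' i i'
    | succ k ih =>
      intro hk
      exact (hΨ k hk).2 _ (ih (Nat.le_of_succ_le hk))
  refine ⟨c, ?_⟩
  have h := (hrun m le_rfl).choi_partialTrace
  rw [hSC m le_rfl, hCn] at h
  rw [c.rep_eq_pad]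
  congr 1
  rw [CoStrategy.partialRep]
  refine (congrArg (fun A : Op _ => relabel (Equiv.prodComm _ _) A.transpose) h).trans ?_
  rfl

theorem strategyReps_eq (n : ℕ) :
    strategyReps n X Y = traceSlice (strategySpace X Y n) (Fintype.card (Tens X n)) := by
  refine Set.Subset.antisymm ?_ (traceSlice_subset_strategyReps n)
  rintro R ⟨s, rfl⟩
  exact s.rep_mem

theorem coStrategyReps_eq (m : ℕ) :
    coStrategyReps m X Y =
      traceSlice (coStrategySpace X Y (m + 1)) (Fintype.card (Tens Y (m + 1))) := by
  refine Set.Subset.antisymm ?_ (traceSlice_subset_coStrategyReps m)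
  rintro R ⟨c, rfl⟩
  exact c.rep_mem

end Realization

/-! ### Interactions -/

section Link

open Matrix

variable {a b z w x o : Type*} [Fintype a] [DecidableEq a] [Fintype b] [DecidableEq b]

/-- The joint state of the memories `z` and `w` obtained by closing the loop between super-operators
`L(b) → L(a ⊗ z)` and `L(a) → L(b ⊗ w)`. -/
def link (F : SuperOp b (a × z)) (G : SuperOp a (b × w)) : Op (z × w) :=
  Matrix.of fun p q => ∑ i, ∑ i', ∑ j, ∑ j',
    choi F ((j, p.1), i) ((j', q.1), i') * choi G ((i, p.2), j) ((i', q.2), j')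

theorem link_comm (F : SuperOp b (a × z)) (G : SuperOp a (b × w)) (k k' : z) (l l' : w) :
    link F G (k, l) (k', l') = link G F (l, k) (l', k') := by
  have h1 : link F G (k, l) (k', l') = ∑ t : b × b × a × a,
      choi F ((t.2.2.1, k), t.1) ((t.2.2.2, k'), t.2.1) *
        choi G ((t.1, l), t.2.2.1) ((t.2.1, l'), t.2.2.2) := by
    simp only [link, Matrix.of_apply, Fintype.sum_prod_type]
  have h2 : link G F (l, k) (l', k') = ∑ t : a × a × b × b,
      choi G ((t.2.2.1, l), t.1) ((t.2.2.2, l'), t.2.1) *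
        choi F ((t.1, k), t.2.2.1) ((t.2.1, k'), t.2.2.2) := by
    simp only [link, Matrix.of_apply, Fintype.sum_prod_type]
  rw [h1, h2]
  refine Fintype.sum_equiv ⟨fun t => (t.2.2.1, t.2.2.2, t.1, t.2.1),
    fun t => (t.2.2.1, t.2.2.2, t.1, t.2.1), fun _ => rfl, fun _ => rfl⟩ _ _ fun t => ?_
  exact mul_comm _ _

/-- `hM` says that `M` is a link in which the factor `x` of `G` is still open. Applying `Φ` closes
it and absorbs `Φ` into `F`; both sides are one sum over all contracted indices, in different order.
-/
theorem tensorId_link [Fintype x] [DecidableEq x] [Fintype z] [DecidableEq z]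
    (F : SuperOp b (a × z)) (G : SuperOp a ((b × x) × w)) (Φ : SuperOp (x × z) o)
    {M : Op ((x × z) × w)} (hM : ∀ l l' k k' q q', M ((l, k), q) ((l', k'), q') =
      link F (relabel (Equiv.prodAssoc b x w) ∘ₗ G) (k, (l, q)) (k', (l', q'))) :
    Φ.tensorId w M = link (feed F Φ) G := by
  ext ⟨r, q⟩ ⟨r', q'⟩
  change Φ (Matrix.of fun s t => M (s, q) (t, q')) r r' = _
  rw [apply_eq_sum_choi]
  have h1 : ∑ i, ∑ i', (Matrix.of fun s t => M (s, q) (t, q')) i i' * choi Φ (r, i) (r', i') =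
      ∑ t : (x × z) × (x × z) × b × b × a × a,
        choi F ((t.2.2.2.2.1, t.1.2), t.2.2.1) ((t.2.2.2.2.2, t.2.1.2), t.2.2.2.1) *
        choi G (((t.2.2.1, t.1.1), q), t.2.2.2.2.1) (((t.2.2.2.1, t.2.1.1), q'), t.2.2.2.2.2) *
        choi Φ (r, t.1) (r', t.2.1) := by
    simp only [Fintype.sum_prod_type, Matrix.of_apply, hM, link, Finset.sum_mul, choi_relabel]
    rfl
  have h2 : link (feed F Φ) G (r, q) (r', q') =
      ∑ t : (b × x) × (b × x) × a × a × z × z,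
        choi F ((t.2.2.1, t.2.2.2.2.1), t.1.1) ((t.2.2.2.1, t.2.2.2.2.2), t.2.1.1) *
        choi Φ (r, (t.1.2, t.2.2.2.2.1)) (r', (t.2.1.2, t.2.2.2.2.2)) *
        choi G ((t.1, q), t.2.2.1) ((t.2.1, q'), t.2.2.2.1) := by
    simp only [Fintype.sum_prod_type, Matrix.of_apply, link, Finset.sum_mul, choi_feed]
  rw [h1, h2]
  refine Fintype.sum_equiv ⟨fun t => ((t.2.2.1, t.1.1), (t.2.2.2.1, t.2.1.1), t.2.2.2.2.1,
      t.2.2.2.2.2, t.1.2, t.2.1.2),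
    fun t => ((t.1.2, t.2.2.2.2.1), (t.2.1.2, t.2.2.2.2.2), t.1.1, t.2.1.1, t.2.2.1, t.2.2.2.1),
    fun _ => rfl, fun _ => rfl⟩ _ _ fun t => ?_
  exact mul_right_comm _ _ _

/-- Both sides contract every index. The transposition built into representations of co-strategies
is what turns the contraction into the trace of a product. -/
theorem trace_kronecker_mul_link [Fintype z] [Fintype w] (F : SuperOp b (a × z))
    (G : SuperOp a (b × w)) (P : Op z) (Q : Op w) :
    ((P ⊗ₖ Q) * link F G).trace = (choi (effect P ∘ₗ F) *
      relabel (Equiv.prodComm b a) (choi (effect Q ∘ₗ G)).transpose).trace := by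
  have h1 : ((P ⊗ₖ Q) * link F G).trace = ∑ t : (z × w) × (z × w) × b × b × a × a,
      P t.1.1 t.2.1.1 * Q t.1.2 t.2.1.2 *
        (choi F ((t.2.2.2.2.1, t.2.1.1), t.2.2.1) ((t.2.2.2.2.2, t.1.1), t.2.2.2.1) *
        choi G ((t.2.2.1, t.2.1.2), t.2.2.2.2.1) ((t.2.2.2.1, t.1.2), t.2.2.2.2.2)) := by
    simp only [Fintype.sum_prod_type, Matrix.of_apply, link, Finset.mul_sum, Matrix.trace,
      Matrix.diag, Matrix.mul_apply, kroneckerMap_apply]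
  have h2 : (choi (effect P ∘ₗ F) *
      relabel (Equiv.prodComm b a) (choi (effect Q ∘ₗ G)).transpose).trace =
      ∑ t : (a × b) × (a × b) × (w × w) × z × z,
        (P t.2.2.2.1 t.2.2.2.2 *
          choi F ((t.1.1, t.2.2.2.2), t.1.2) ((t.2.1.1, t.2.2.2.1), t.2.1.2)) *
        (Q t.2.2.1.1 t.2.2.1.2 *
          choi G ((t.1.2, t.2.2.1.2), t.1.1) ((t.2.1.2, t.2.2.1.1), t.2.1.1)) := by
    have h3 : ∀ (j j' : a) (i i' : b),
        relabel (Equiv.prodComm b a) (choi (effect Q ∘ₗ G)).transpose (j', i') (j, i) =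
        choi (effect Q ∘ₗ G) (i, j) (i', j') := fun _ _ _ _ => rfl
    simp only [Fintype.sum_prod_type, Matrix.trace, Matrix.diag, Matrix.mul_apply, h3, choi_effect,
      Finset.sum_mul, Finset.mul_sum]
  rw [h1, h2]
  refine Fintype.sum_equiv ⟨fun t => ((t.2.2.2.2.1, t.2.2.1), (t.2.2.2.2.2, t.2.2.2.1),
      (t.1.2, t.2.1.2), t.1.1, t.2.1.1),
    fun t => ((t.2.2.2.1, t.2.2.1.1), (t.2.2.2.2, t.2.2.1.2), t.1.2, t.2.1.2, t.1.1, t.2.1.1),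
    fun _ => rfl, fun _ => rfl⟩ _ _ fun t => ?_
  exact mul_mul_mul_comm _ _ _ _

end Link

/-! ### Output probabilities as trace pairings -/

section Interaction

open Matrix

set_option linter.unusedSectionVars false

variable {n m : ℕ} {X Y : ℕ → Type u}
variable [∀ k, Fintype (X k)] [∀ k, DecidableEq (X k)] [∀ k, Fintype (Y k)] [∀ k, DecidableEq (Y k)]

/-- A round absorbs `s.Φ k` into the strategy's run and then, with the parties exchanged by
`link_comm`, `Ψ` into the co-strategy's. Leaving `Ψ` general covers the last map too. -/
theorem idTensor_strategyMove (s : Strategy n X Y) (c : CoStrategy m X Y) (k : ℕ) {o : Type*}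
    (Ψ : SuperOp (Y k × c.W k) o) {σ : Op (s.Z k × (X k × c.W k))}
    (hσ : σ = link (s.run k) (relabel (Equiv.prodAssoc (Tens X k) (X k) (c.W k)) ∘ₗ c.run k)) :
    SuperOp.idTensor (s.Z (k + 1)) Ψ (strategyMove s c k σ) =
      link (s.run (k + 1)) (feed (c.run k) Ψ) := by
  have h1 := tensorId_link (s.run k) (c.run k) (s.Φ k)
    (M := relabel ((Equiv.prodAssoc (s.Z k) (X k) (c.W k)).symm.trans
        ((Equiv.prodComm (s.Z k) (X k)).prodCongr (Equiv.refl (c.W k)))) σ)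
    (fun l l' k k' q q' => by rw [← hσ]; rfl)
  have h2 := tensorId_link (c.run k) (s.run (k + 1)) Ψ
    (M := relabel (Equiv.prodComm (s.Z (k + 1)) (Y k × c.W k)) (strategyMove s c k σ))
    (fun l l' q q' r r' => by
      refine Eq.trans ?_ (link_comm _ _ _ _ _ _)
      exact congrFun (congrFun h1 ((l, r), q)) ((l', r'), q'))
  ext ⟨r, q⟩ ⟨r', q'⟩
  exact (congrFun (congrFun h2 (q, r)) (q', r')).trans (link_comm _ _ _ _ _ _)

theorem interaction_eq_link (s : Strategy n X Y) (c : CoStrategy m X Y) : ∀ k,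
    interaction s c k =
      link (s.run k) (relabel (Equiv.prodAssoc (Tens X k) (X k) (c.W k)) ∘ₗ c.run k)
  | 0 => by
    ext ⟨r, y, q⟩ ⟨r', y', q'⟩
    have h : ∀ (i i' : Tens X 0) (j j' : Tens Y 0),
        choi (s.run 0) ((j, r), i) ((j', r'), i') *
          choi (relabel (Equiv.prodAssoc (Tens X 0) (X 0) (c.W 0)) ∘ₗ c.run 0)
            ((i, (y, q)), j) ((i', (y', q')), j') = (1 : Op (s.Z 0)) r r' * c.ρ (y, q) (y', q') := by
      intro i i' j j'
      refine congrArg₂ (· * ·) ?_ ((choi_relabel (Equiv.prodAssoc (Tens X 0) (X 0) (c.W 0))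
        (c.run 0) (i, (y, q)) (i', (y', q')) j j').trans (c.choi_run_zero i i' y y' q q' j j'))
      refine (choi_appendState (a := Tens X 0) (1 : Op (s.Z 0)) j j' r r' i i').trans ?_
      exact (congrArg (· * (1 : Op (s.Z 0)) r r') (single_tens_zero (X := X) i i' j j')).trans
        (one_mul _)
    simp only [link, Matrix.of_apply, h]
    simp [interaction, card_tens_zero]
  | k + 1 => idTensor_strategyMove s c k (c.Ψ k) (interaction_eq_link s c k)

theorem outputProb_eq (s : Strategy (m + 1) X Y) (c : CoStrategy m X Y) {P : Op (s.Z (m + 1))}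
    {Q : Op c.Wlast} (hP : P.IsHermitian) (hQ : Q.IsHermitian) :
    outputProb s c P Q = (choi (effect P ∘ₗ s.run (m + 1)) *
      relabel (Equiv.prodComm (Tens X (m + 1)) (Tens Y (m + 1)))
        (choi (effect Q ∘ₗ c.runAll)).transpose).trace.re := by
  rw [outputProb, conjTranspose_kronecker, hP.eq, hQ.eq, ← trace_kronecker_mul_link]
  congr 3
  exact idTensor_strategyMove s c m c.Ψlast (interaction_eq_link s c m)

theorem outputProb_strategy_measures (s : Strategy (m + 1) X Y) (c : CoStrategy m X Y)
    {S : Type v} [Fintype S] (M : Measurement S (s.Z (m + 1))) (a : S) :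
    outputProb s c (M.op a) 1 = (s.measRep M a * c.rep).trace.re := by
  rw [outputProb_eq s c (M.posSemidef a).1 isHermitian_one, effect_one]
  rfl

theorem outputProb_coStrategy_measures (s : Strategy (m + 1) X Y) (c : CoStrategy m X Y)
    {S : Type v} [Fintype S] (M : Measurement S c.Wlast) (b : S) :
    outputProb s c 1 (M.op b) = (c.measRep M b * s.rep).trace.re := by
  rw [outputProb_eq s c isHermitian_one (M.posSemidef b).1, effect_one, trace_mul_comm]
  rfl

end Interaction

theorem theorem3 (m : ℕ) (X Y : ℕ → Type u)
    [∀ k, Fintype (X k)] [∀ k, DecidableEq (X k)] [∀ k, Nonempty (X k)]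
    [∀ k, Fintype (Y k)] [∀ k, DecidableEq (Y k)] [∀ k, Nonempty (Y k)]
    (S : Type v) [Fintype S] :
    (∀ (s : Strategy (m + 1) X Y) (M : Measurement S (s.Z (m + 1))) (a : S),
      ∃ p : ℝ,
        IsGreatest {q : ℝ | ∃ c : CoStrategy m X Y, q = outputProb s c (M.op a) 1} p ∧
        IsLeast {q : ℝ | q ∈ Set.Icc (0 : ℝ) 1 ∧
          ∃ R ∈ strategyReps (m + 1) X Y, ((q : ℂ) • R - s.measRep M a).PosSemidef} p) ∧
    (∀ (c : CoStrategy m X Y) (M : Measurement S c.Wlast) (b : S),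
      ∃ p : ℝ,
        IsGreatest {q : ℝ | ∃ s : Strategy (m + 1) X Y, q = outputProb s c 1 (M.op b)} p ∧
        IsLeast {q : ℝ | q ∈ Set.Icc (0 : ℝ) 1 ∧
          ∃ R ∈ coStrategyReps m X Y, ((q : ℂ) • R - c.measRep M b).PosSemidef} p) := by
  have hdual := dualPair_strategySpace X Y (m + 1)
  have hX : (0 : ℝ) < Fintype.card (Tens X (m + 1)) := by exact_mod_cast Fintype.card_pos
  have hY : (0 : ℝ) < Fintype.card (Tens Y (m + 1)) := by exact_mod_cast Fintype.card_pos
  have hcard : (Fintype.card (Tens X (m + 1)) : ℝ) * Fintype.card (Tens Y (m + 1)) =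
      Fintype.card (Tens Y (m + 1) × Tens X (m + 1)) := by
    rw [Fintype.card_prod, mul_comm]
    push_cast
    rfl
  refine ⟨fun s M a => ?_, fun c M b => ?_⟩
  · obtain ⟨p, h1, h2⟩ := exists_isGreatest_isLeast hX hY hcard hdual.one_left hdual.one_right
      hdual.star_left hdual.pairing hdual.orth_left (s.posSemidef_measRep M a) s.rep_mem
      (s.posSemidef_rep_sub_measRep M a)
    rw [← strategyReps_eq] at h2
    rw [← coStrategyReps_eq] at h1
    refine ⟨p, ?_, h2⟩
    convert h1 using 1
    ext q
    simp only [outputProb_strategy_measures, coStrategyReps, Set.mem_ofPred_eq, exists_exists_eq_and]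
  -- Dual pairs are symmetric, so the same duality applies with the subspaces and normalizations
  -- exchanged.
  · obtain ⟨p, h1, h2⟩ := exists_isGreatest_isLeast hY hX (by rw [mul_comm, hcard])
      hdual.one_right hdual.one_left hdual.star_right hdual.symm.pairing hdual.orth_right
      (c.posSemidef_measRep M b) c.rep_mem (c.posSemidef_rep_sub_measRep M b)
    rw [← coStrategyReps_eq] at h2
    rw [← strategyReps_eq] at h1
    refine ⟨p, ?_, h2⟩
    convert h1 using 1
    ext q
    simp only [outputProb_coStrategy_measures, strategyReps, Set.mem_ofPred_eq, exists_exists_eq_and]
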